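/- Let $F\in\mathbb C[x,y,z]$ be an irreducible homogeneous polynomial of degree $d\ge 2$ and let $\mathcal C=V(F)\subset\mathbb P^2=\mathbb P^2(\mathbb C)$. For $S=[x_0:y_0:z_0]\in\mathbb P^2$ put $$\Delta_SF=x_0F_x+y_0F_y+z_0F_z,\qquad \sigma_S=(F_x^2+F_y^2)\,(x_0,y_0,z_0)-2\,\Delta_SF\,(F_x,F_y,0),$$ so that, for $m\in\mathcal C$ with $F_x^2+F_y^2\neq0$ at $m$, $\sigma_S(m)$ represents the image of $S$ under the orthogonal symmetry with respect to the tangent line to $\mathcal C$ at $m$. Let $\rho_{F,S}$ be the rational map $$\rho_{F,S}=(x,y,z)\wedge\sigma_S ,$$ which sends $m$ to (the coefficients of) the reflected line $\mathcal R_{m,S,\mathcal C}=(m\,\sigma_S(m))$, and let the caustic map $\Phi_{F,S}$ be the rational map on $\mathcal C$ which sends $m$ to the point at which $\mathcal R_{m,S,\mathcal C}$ touches the envelope of the reflected lines, that is $$\Phi_{F,S}=\rho_{F,S}\wedge\bigl(F_x\,\partial_y\rho_{F,S}-F_y\,\partial_x\rho_{F,S}\bigr).$$ Then, for a generic $S\in\mathbb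 P^2$, both $\rho_{F,S}$ and $\Phi_{F,S}$ are birational on $\mathcal C$. That is, there is an algebraic curve $\mathcal B\subset\mathbb P^2$ such that for every $S\in\mathbb P^2\setminus\mathcal B$ the restriction to $\mathcal C$ of each of the rational maps $\rho_{F,S}$ and $\Phi_{F,S}$ is a birational map from $\mathcal C$ onto the Zariski closure of its image. -/

import Mathlib

open MvPolynomial
open scoped Matrix LinearAlgebra.Projectivization

/-- The complex projective plane. -/
abbrev P2 : Type := ℙ ℂ (Fin 3 → ℂ)

/-- Polynomials in the homogeneous coordinates `x = X 0`, `y = X 1`, `z = X 2`. -/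
abbrev Poly3 : Type := MvPolynomial (Fin 3) ℂ

/-- `V(G)`, for a homogeneous polynomial `G` (the choice of representative is then irrelevant). -/
def projZeroLocus (G : Poly3) : Set P2 := {p | eval p.rep G = 0}

/-- The Zariski closure of a set of points: the common zeros of all homogeneous polynomials
vanishing on it. -/
def zariskiClosure (A : Set P2) : Set P2 :=
  {p | ∀ (n : ℕ) (G : Poly3), G.IsHomogeneous n → A ⊆ projZeroLocus G → p ∈ projZeroLocus G}

/-- Algebraic subsets of the plane. -/
def IsZariskiClosed (A : Set P2) : Prop := zariskiClosure A = A

/-- A rational map of the plane to itself, given by three forms of the same degree. -/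
structure PlaneRatMap where
  coord : Fin 3 → Poly3
  deg : ℕ
  homogeneous : ∀ i, (coord i).IsHomogeneous deg

/-- `f.Sends p q`: the three forms do not all vanish at `p`, and their values are
homogeneous coordinates of `q`. -/
def PlaneRatMap.Sends (f : PlaneRatMap) (p q : P2) : Prop :=
  ∃ h : (fun i => eval p.rep (f.coord i)) ≠ 0,
    Projectivization.mk ℂ (fun i => eval p.rep (f.coord i)) h = q

/-- The Zariski closure of the image of `A`. -/
def PlaneRatMap.closedImage (f : PlaneRatMap) (A : Set P2) : Set P2 :=
  zariskiClosure {q | ∃ p ∈ A, f.Sends p q}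

/-- For an irreducible algebraic set `A`, the rational map `f` restricts to a birational map from
`A` onto the closure `D` of its image: there are a rational map `g` and nonempty Zariski open
subsets `A \ Z` of `A` and `D \ W` of `D` between which `f` and `g` are mutually inverse. -/
def PlaneRatMap.IsBirationalOn (f : PlaneRatMap) (A : Set P2) : Prop :=
  ∃ (g : PlaneRatMap) (Z W : Set P2), IsZariskiClosed Z ∧ IsZariskiClosed W ∧
    (A \ Z).Nonempty ∧ (f.closedImage A \ W).Nonempty ∧
    (∀ p ∈ A \ Z, ∃ q ∈ f.closedImage A \ W, f.Sends p q ∧ g.Sends q p) ∧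
    (∀ q ∈ f.closedImage A \ W, ∃ p ∈ A \ Z, g.Sends q p ∧ f.Sends p q)

/-- The orthogonal symmetry with respect to the line `a₀ x + a₁ y + a₂ z = 0`, in homogeneous
coordinates: `(a₀² + a₁²) s - 2 (a₀ s₀ + a₁ s₁ + a₂ s₂) (a₀, a₁, 0)`. -/
def orthSymm {R : Type*} [CommRing R] (a s : Fin 3 → R) : Fin 3 → R :=
  (a 0 ^ 2 + a 1 ^ 2) • s - (2 * (a ⬝ᵥ s)) • ![a 0, a 1, 0]

/-- The gradient of `F`: the coefficients of the tangent line to `V(F)`. -/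
noncomputable def gradPoly (F : Poly3) : Fin 3 → Poly3 := fun i => pderiv i F

/-- The coefficients of the reflected line, that is, the line through `m = [x : y : z]` and the
image of the light position `s` under the orthogonal symmetry in the tangent to `V(F)` at `m`. -/
noncomputable def rhoCoord (F : Poly3) (s : Fin 3 → ℂ) : Fin 3 → Poly3 :=
  (X : Fin 3 → Poly3) ⨯₃ orthSymm (gradPoly F) (fun i => C (s i))

/-- Differentiation along `V(F)` in the affine chart `z = 1`: the tangent vector is
`(-F_y, F_x)`. -/
noncomputable def tangentDeriv (F H : Poly3) : Poly3 :=
  pderiv 0 F * pderiv 1 H - pderiv 1 F * pderiv 0 H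

/-- The point where the reflected line touches the envelope of the reflected lines: the
intersection of the reflected line with its derivative along the curve. -/
noncomputable def phiCoord (F : Poly3) (s : Fin 3 → ℂ) : Fin 3 → Poly3 :=
  rhoCoord F s ⨯₃ (fun i => tangentDeriv F (rhoCoord F s i))

theorem isHomogeneous_cross {u v : Fin 3 → Poly3} {m n : ℕ} (hu : ∀ i, (u i).IsHomogeneous m)
    (hv : ∀ i, (v i).IsHomogeneous n) (i : Fin 3) : ((u ⨯₃ v) i).IsHomogeneous (m + n) := by
  rw [cross_apply]
  fin_cases i
  · exact ((hu 1).mul (hv 2)).sub ((hu 2).mul (hv 1))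
  · exact ((hu 2).mul (hv 0)).sub ((hu 0).mul (hv 2))
  · exact ((hu 0).mul (hv 1)).sub ((hu 1).mul (hv 0))

theorem isHomogeneous_orthSymm {F : Poly3} {d : ℕ} (hF : F.IsHomogeneous d) (s : Fin 3 → ℂ)
    (i : Fin 3) :
    (orthSymm (gradPoly F) (fun i => C (s i)) i).IsHomogeneous ((d - 1) + (d - 1)) := by
  have hg : ∀ j, (gradPoly F j).IsHomogeneous (d - 1) := fun j => hF.pderiv
  have hs : ∀ j, (C (s j) : Poly3).IsHomogeneous 0 := fun j => isHomogeneous_C _ _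
  have h2 : (2 : Poly3).IsHomogeneous 0 := isHomogeneous_C _ (2 : ℂ)
  have hn : ∀ j, ((![gradPoly F 0, gradPoly F 1, 0] : Fin 3 → Poly3) j).IsHomogeneous (d - 1) := by
    intro j
    fin_cases j
    · exact hg 0
    · exact hg 1
    · exact isHomogeneous_zero _ _ _
  have hd : (gradPoly F ⬝ᵥ fun i => C (s i)).IsHomogeneous (d - 1) :=
    IsHomogeneous.sum _ _ _ fun j _ => (hg j).mul (hs j)
  have h1 : (gradPoly F 0 ^ 2 + gradPoly F 1 ^ 2).IsHomogeneous ((d - 1) + (d - 1)) := by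
    rw [sq, sq]
    exact ((hg 0).mul (hg 0)).add ((hg 1).mul (hg 1))
  have h3 := (h2.mul hd).mul (hn i)
  rw [zero_add] at h3
  exact (h1.mul (hs i)).sub h3

theorem isHomogeneous_rhoCoord {F : Poly3} {d : ℕ} (hF : F.IsHomogeneous d) (s : Fin 3 → ℂ)
    (i : Fin 3) : (rhoCoord F s i).IsHomogeneous (1 + ((d - 1) + (d - 1))) :=
  isHomogeneous_cross (fun j => isHomogeneous_X _ j) (isHomogeneous_orthSymm hF s) i

/-- The map `ρ_{F,s}`, sending a point of `V(F)` to the reflected line (the line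
`a x + b y + c z = 0` being regarded as the point `[a : b : c]`). -/
noncomputable def rhoMap (F : Poly3) {d : ℕ} (hF : F.IsHomogeneous d) (s : Fin 3 → ℂ) :
    PlaneRatMap where
  coord := rhoCoord F s
  deg := 1 + ((d - 1) + (d - 1))
  homogeneous := isHomogeneous_rhoCoord hF s

/-- The caustic map `Φ_{F,s}`. -/
noncomputable def phiMap (F : Poly3) {d : ℕ} (hF : F.IsHomogeneous d) (s : Fin 3 → ℂ) :
    PlaneRatMap where
  coord := phiCoord F s
  deg := (1 + ((d - 1) + (d - 1))) + ((d - 1) + (1 + ((d - 1) + (d - 1)) - 1))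
  homogeneous := isHomogeneous_cross (isHomogeneous_rhoCoord hF s) fun i =>
    (hF.pderiv.mul (isHomogeneous_rhoCoord hF s i).pderiv).sub
      (hF.pderiv.mul (isHomogeneous_rhoCoord hF s i).pderiv)

/-! Let `t` be the tangent at the point `x`, `σ` the symmetry in it, and `r = x × σ(s)` the
reflected line. The key is to let the light position `s` vary too. Take a relation `H(s, Y)`
satisfied by `Y = r`, of least degree in `Y`, and put `w = ∂H/∂Y`, `l = ∂H/∂s` at `Y = r`;
minimality makes `w` nonzero on the curve. Differentiating `H(s, r) = 0` in the light gives `l·v +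
w·(x × σ(v)) = 0` for all `v`. Since `x` lies on its tangent, `σ` fixes it up to a factor, so `v =
x` yields `l·x = 0`. As also `r·x = 0`, the vector `r × l` is a multiple of `x`: the forms `Y ×
∂H/∂s` invert the map (`exists_family_inverse`).

This multiple is not zero (`cross_reflected_ne_zero`). Otherwise `l·s = 0` with `r·s ≠ 0` forces `l
= 0`, hence `w` is parallel to `x`; then `w·r' = 0` along the curve gives `x·r' = 0`, so `x'·r = 0`,
and the reflected line would contain the tangent direction. Fixing `s` off a hypersurface keeps the
inverse (`exists_hasFormInverse_rhoCoord`).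

The caustic map is handled by biduality (`hasFormInverse_envelope`). With `φ = r × r'`, the line `r`
is orthogonal to `φ` and `φ'`, and so is the gradient of a minimal equation satisfied by `φ`. This
gradient therefore recovers `r` from `φ`, and the previous inverse recovers `x`. The argument fails
only if the reflected lines are concurrent, which `exists_rhoCoord_nonlinear` excludes for generic
`s`. Identities modulo `F` become birationality through `isBirationalOn_of_hasFormInverse`. -/

/-! ### Polynomial relations on an irreducible hypersurface -/

section General

variable {σ : Type}

theorem isWeightedHomogeneous_aeval_scale {B : Type*} [CommRing B] [Algebra ℂ B] {w : σ → ℕ}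
    {n : ℕ} {H : MvPolynomial σ ℂ} (hH : H.IsWeightedHomogeneous w n) (c : B) (z : σ → B) :
    aeval (fun i => c ^ w i * z i) H = c ^ n * aeval z H := by
  induction hH using IsWeightedHomogeneous.induction_on with
  | zero => simp
  | add p q hp hq h1 h2 => simp only [map_add, h1, h2, mul_add]
  | monomial d r hr =>
    subst hr
    simp only [aeval_monomial, mul_pow, Finsupp.weight_apply,
      Finsupp.sum, Finsupp.prod]
    have : ∏ i ∈ d.support, (c ^ w i) ^ d i = c ^ ∑ i ∈ d.support, d i • w i := by
      rw [← Finset.prod_pow_eq_pow_sum]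
      exact Finset.prod_congr rfl fun i _ => by rw [← pow_mul, smul_eq_mul, mul_comm]
    simp only [Finset.prod_mul_distrib, this]
    ring

theorem isHomogeneous_aeval_smul {B : Type*} [CommRing B] [Algebra ℂ B] {n : ℕ}
    {H : MvPolynomial σ ℂ} (hH : H.IsHomogeneous n) (c : B) (z : σ → B) :
    aeval (c • z) H = c ^ n * aeval z H := by
  have := isWeightedHomogeneous_aeval_scale (w := 1) hH c z
  simpa [Pi.smul_def] using this

theorem isHomogeneous_eval_smul {n : ℕ} {H : MvPolynomial σ ℂ} (hH : H.IsHomogeneous n) (c : ℂ)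
    (z : σ → ℂ) : eval (c • z) H = c ^ n * eval z H := by
  exact isHomogeneous_aeval_smul hH c z

variable [Fintype σ]

/-- Nullstellensatz: the prime ideal generated by `F` is the full vanishing ideal of its zero locus.
-/
theorem dvd_of_vanishes_on_zeros {F G : MvPolynomial σ ℂ} (hF : Prime F)
    (h : ∀ z : σ → ℂ, eval z F = 0 → eval z G = 0) : F ∣ G := by
  have hP : (Ideal.span {F}).IsPrime := (Ideal.span_singleton_prime hF.ne_zero).2 hF
  have hV := IsPrime.vanishingIdeal_zeroLocus (K := ℂ) (Ideal.span {F})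
  rw [← Ideal.mem_span_singleton, ← hV, mem_vanishingIdeal_iff]
  intro z hz
  have := h z
  simp only [← coe_aeval_eq_eval, RingHom.coe_coe] at this
  exact this (hz F (Ideal.mem_span_singleton_self F))

theorem exists_zero_eval_ne_zero {F G : MvPolynomial σ ℂ} (hF : Prime F) (h : ¬ F ∣ G) :
    ∃ z : σ → ℂ, eval z F = 0 ∧ eval z G ≠ 0 := by
  by_contra! hc
  exact h (dvd_of_vanishes_on_zeros hF hc)

/-- Chain rule for a derivation applied to a polynomial expression. -/
theorem derivation_aeval {B : Type*} [CommRing B] [Algebra ℂ B] (D : Derivation ℂ B B)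
    (b : σ → B) (H : MvPolynomial σ ℂ) :
    D (aeval b H) = ∑ i, aeval b (pderiv i H) * D (b i) := by
  classical
  induction H using MvPolynomial.induction_on with
  | C a => simp
  | add p q hp hq => simp [hp, hq, add_mul, Finset.sum_add_distrib]
  | mul_X p j hp =>
    simp only [map_mul, aeval_X, Derivation.leibniz, smul_eq_mul, hp, map_add, pderiv_X, add_mul,
      Finset.sum_add_distrib, Finset.mul_sum]
    congr 1
    · simp [Pi.single_apply, apply_ite, ite_mul]
    · exact Finset.sum_congr rfl fun i _ => by ring

theorem dvd_derivation_of_dvd {B : Type*} [CommRing B] [Algebra ℂ B] (D : Derivation ℂ B B)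
    {F G : B} (hF : F ∣ D F) (hG : F ∣ G) : F ∣ D G := by
  obtain ⟨K, rfl⟩ := hG
  rw [Derivation.leibniz, smul_eq_mul, smul_eq_mul]
  exact dvd_add (Dvd.intro _ rfl) (Dvd.dvd.mul_left hF K)

/-- As many elements of the coordinate ring of a hypersurface as there are variables are
algebraically dependent. -/
theorem exists_dvd_aeval {F : MvPolynomial σ ℂ} (hF : Prime F) (b : σ → MvPolynomial σ ℂ) :
    ∃ H : MvPolynomial σ ℂ, H ≠ 0 ∧ F ∣ aeval b H := by
  classical
  have hP : (Ideal.span {F}).IsPrime := (Ideal.span_singleton_prime hF.ne_zero).2 hF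
  let q : MvPolynomial σ ℂ →ₐ[ℂ] MvPolynomial σ ℂ ⧸ Ideal.span {F} := Ideal.Quotient.mkₐ ℂ _
  have hq : ∀ G, q G = 0 ↔ F ∣ G := fun G => Ideal.Quotient.eq_zero_iff_dvd F G
  have hqs : Function.Surjective q := Ideal.Quotient.mkₐ_surjective ℂ _
  have key : ∀ (a : σ → MvPolynomial σ ℂ) (H : MvPolynomial σ ℂ),
      aeval (fun i => q (a i)) H = q (aeval a H) := by
    intro a H
    rw [← AlgHom.comp_apply, comp_aeval]
  by_contra! hc
  have hb : AlgebraicIndependent ℂ (fun i => q (b i)) := by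
    rw [algebraicIndependent_iff]
    intro p hp
    by_contra hp0
    exact hc p hp0 ((hq _).1 (by rw [← key, hp]))
  let f : σ → MvPolynomial σ ℂ ⧸ Ideal.span {F} := fun i => q (X i)
  have hadj : Algebra.adjoin ℂ (Set.range f) = ⊤ := by
    have : Set.range f = q '' Set.range X := by rw [← Set.range_comp]; rfl
    rw [this, Algebra.adjoin_image, adjoin_range_X, Algebra.map_top]
    exact (AlgHom.range_eq_top q).2 hqs
  have : Algebra.IsAlgebraic (Algebra.adjoin ℂ (Set.range f))
      (MvPolynomial σ ℂ ⧸ Ideal.span {F}) := by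
    refine ⟨fun x => ?_⟩
    have hx : x ∈ Algebra.adjoin ℂ (Set.range f) := by rw [hadj]; trivial
    exact isAlgebraic_algebraMap (⟨x, hx⟩ : Algebra.adjoin ℂ (Set.range f))
  -- A transcendence basis chosen among the coordinate functions must, by cardinality, use all of
  -- them; but `F` is a nontrivial relation between them.
  obtain ⟨t, hts, ht⟩ := exists_isTranscendenceBasis_subset (R := ℂ) (Set.range f)
  have h1 := hb.lift_cardinalMk_le_trdeg
  rw [Cardinal.lift_id, Cardinal.lift_id, ← ht.cardinalMk_eq_trdeg, Cardinal.mk_fintype] at h1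
  have htf : t.Finite := (Set.finite_range f).subset hts
  have := htf.fintype
  rw [Cardinal.mk_fintype] at h1
  have h2 : Fintype.card σ ≤ Fintype.card t := by exact_mod_cast h1
  have h3 : t.toFinset ⊆ Finset.univ.image f := by
    intro x hx
    simpa using hts (Set.mem_toFinset.1 hx)
  have h4 : (Finset.univ.image f).card ≤ Fintype.card σ := Finset.card_image_le
  have h5 : t.toFinset = Finset.univ.image f := by
    apply Finset.eq_of_subset_of_card_le h3
    rw [Set.toFinset_card]
    omega
  have h6 : Function.Injective f := by
    have : (Finset.univ.image f).card = (Finset.univ : Finset σ).card := by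
      rw [← h5, Set.toFinset_card, Finset.card_univ]
      rw [← h5, Set.toFinset_card] at h4
      omega
    simpa using Finset.card_image_iff.1 this
  have h7 : t = Set.range f := by
    rw [← Set.coe_toFinset t, h5]; simp
  subst h7
  have h8 : AlgebraicIndependent ℂ f := (algebraicIndependent_subtype_range h6).1 ht.1
  refine hF.ne_zero ((algebraicIndependent_iff.1 h8) F ?_)
  have : aeval f F = q (aeval X F) := key X F
  rw [this, hq, aeval_X_left_apply]

/-- Rescaling a zero of `F` by `c` multiplies the component of weight `m` by `c ^ (e * m)`. The sum
vanishes for every `c`, and `0 < e` keeps the exponents distinct, so each component vanishes. -/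
theorem dvd_aeval_weightedHomogeneousComponent {F : MvPolynomial σ ℂ} (hF : Prime F) {w : σ → ℕ}
    (hFw : ∀ (c : ℂ) z, eval z F = 0 → eval (fun i => c ^ w i * z i) F = 0)
    {e : ℕ} (he : 0 < e) {b : σ → MvPolynomial σ ℂ}
    (hb : ∀ (c : ℂ) z j, eval (fun i => c ^ w i * z i) (b j) = (c ^ e) ^ w j * eval z (b j))
    {H : MvPolynomial σ ℂ} (hH : F ∣ aeval b H) (n : ℕ) :
    F ∣ aeval b (weightedHomogeneousComponent w n H) := by
  classical
  refine dvd_of_vanishes_on_zeros hF fun z hz => ?_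
  have hev : ∀ (z : σ → ℂ) (K : MvPolynomial σ ℂ),
      eval z (aeval b K) = aeval (fun j => eval z (b j)) K := by
    intro z K
    have := map_aeval b (eval z) K
    rw [this]
    simp only [aeval_def, coe_eval₂Hom]
    congr 1
    ext a
    simp
  set y : σ → ℂ := fun j => eval z (b j)
  have hsum := sum_weightedHomogeneousComponent w H
  have hfin := weightedHomogeneousComponent_finsupp (w := w) H
  rw [finsum_eq_sum _ hfin] at hsum
  set T := hfin.toFinset
  let p : Polynomial ℂ := ∑ m ∈ T,
    Polynomial.C (aeval y (weightedHomogeneousComponent w m H)) * Polynomial.X ^ (e * m)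
  have hp : p = 0 := by
    refine Polynomial.funext fun c => ?_
    have h0 : eval (fun i => c ^ w i * z i) (aeval b H) = 0 := by
      obtain ⟨K, hK⟩ := hH
      rw [hK, map_mul, hFw c z hz, zero_mul]
    rw [hev] at h0
    simp only [hb] at h0
    rw [← hsum, map_sum] at h0
    simp only [Polynomial.eval_zero, p, Polynomial.eval_finsetSum, Polynomial.eval_mul,
      Polynomial.eval_C, Polynomial.eval_pow, Polynomial.eval_X]
    rw [← h0]
    refine Finset.sum_congr rfl fun m _ => ?_
    rw [isWeightedHomogeneous_aeval_scale
      (weightedHomogeneousComponent_isWeightedHomogeneous m H) (c ^ e) y, mul_comm, pow_mul]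
  rw [hev]
  by_cases hn : n ∈ T
  · have := congrArg (fun P => Polynomial.coeff P (e * n)) hp
    simp only [p, Polynomial.finsetSum_coeff, Polynomial.coeff_C_mul, Polynomial.coeff_X_pow,
      Polynomial.coeff_zero] at this
    rw [Finset.sum_eq_single n] at this
    · simpa using this
    · intro m _ hm
      have : e * n ≠ e * m := fun h => hm (Nat.eq_of_mul_eq_mul_left he h).symm
      simp [this]
    · exact fun h => absurd hn h
  · have : weightedHomogeneousComponent w n H = 0 := by
      by_contra h
      exact hn (hfin.mem_toFinset.2 h)
    simp [this]

/-- The relation of least weight between `b`: a nonzero weighted homogeneous `H` with `H(b) = 0` on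
the hypersurface `F = 0`, some relevant partial derivative of which does not vanish at `b`. -/
theorem exists_minimal_relation {F : MvPolynomial σ ℂ} (hF : Prime F) {w : σ → ℕ}
    (hFw : ∀ (c : ℂ) z, eval z F = 0 → eval (fun i => c ^ w i * z i) F = 0)
    {e : ℕ} (he : 0 < e) {b : σ → MvPolynomial σ ℂ}
    (hb : ∀ (c : ℂ) z j, eval (fun i => c ^ w i * z i) (b j) = (c ^ e) ^ w j * eval z (b j))
    (h0 : ∀ H : MvPolynomial σ ℂ, H.IsWeightedHomogeneous w 0 → F ∣ aeval b H → H = 0) :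
    ∃ (n : ℕ) (H : MvPolynomial σ ℂ), H.IsWeightedHomogeneous w n ∧ H ≠ 0 ∧ F ∣ aeval b H ∧
      (∀ i, w i ≠ 0 → F ∣ aeval b (pderiv i H) → pderiv i H = 0) ∧
      ∃ i, w i ≠ 0 ∧ ¬ F ∣ aeval b (pderiv i H) := by
  classical
  have hex : ∃ n, ∃ H : MvPolynomial σ ℂ, H.IsWeightedHomogeneous w n ∧ H ≠ 0 ∧ F ∣ aeval b H := by
    obtain ⟨H, hH0, hH⟩ := exists_dvd_aeval hF b
    obtain ⟨n, hn⟩ : ∃ n, weightedHomogeneousComponent w n H ≠ 0 := by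
      by_contra! hc
      apply hH0
      rw [← sum_weightedHomogeneousComponent w H]
      simp [hc]
    exact ⟨n, _, weightedHomogeneousComponent_isWeightedHomogeneous n H, hn,
      dvd_aeval_weightedHomogeneousComponent hF hFw he hb hH n⟩
  obtain ⟨H, hHn, hH0, hH⟩ := Nat.find_spec hex
  -- A derivative in a variable of positive weight has smaller weight, so it can satisfy the same
  -- divisibility only by being zero.
  have hmin : ∀ i, w i ≠ 0 → F ∣ aeval b (pderiv i H) → pderiv i H = 0 := by
    intro i hi hd
    by_cases hle : w i ≤ Nat.find hex
    · by_contra hne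
      exact Nat.find_min hex (m := Nat.find hex - w i) (by omega)
        ⟨_, hHn.pderiv (n' := Nat.find hex - w i) (by omega), hne, hd⟩
    · refine pderiv_eq_zero_of_notMem_vars fun hv => ?_
      obtain ⟨d, hd, hdi⟩ := (mem_vars_iff_mem_support i).1 hv
      have h1 := hHn (mem_support_iff.1 hd)
      have h2 := Finsupp.le_weight_of_ne_zero' (w := w) (f := d) (s := i)
        (by simpa using hdi)
      omega
  refine ⟨Nat.find hex, H, hHn, hH0, hH, hmin, ?_⟩
  -- Otherwise Euler's identity leaves a nonzero relation of weight zero, against `h0`.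
  by_contra! hc
  have heul := hHn.sum_weight_X_mul_pderiv
  rw [Finset.sum_eq_zero] at heul
  · rw [eq_comm, smul_eq_zero] at heul
    rcases heul with h | h
    · rw [h] at hHn
      exact hH0 (h0 H hHn hH)
    · exact hH0 h
  · intro i _
    by_cases hi : w i = 0
    · simp [hi]
    · rw [hmin i hi (hc i hi)]; simp

end General

/-! ### From identities modulo `F` to birational maps -/

theorem exists_eq_smul_of_mul_comm {k : Type*} [Field k] {u v : Fin 3 → k} (hv : v ≠ 0)
    (h : ∀ i j, u i * v j = u j * v i) : ∃ c : k, u = c • v := by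
  obtain ⟨j, hj⟩ := Function.ne_iff.1 hv
  refine ⟨u j / v j, funext fun i => ?_⟩
  have hj' : v j ≠ 0 := hj
  simp only [Pi.smul_apply, smul_eq_mul]
  field_simp
  exact h i j

theorem eval_aeval_poly {σ τ : Type*} (z : τ → ℂ) (b : σ → MvPolynomial τ ℂ)
    (K : MvPolynomial σ ℂ) : eval z (aeval b K) = eval (fun j => eval z (b j)) K := by
  rw [map_aeval]
  simp only [coe_eval₂Hom, eval, eval₂_eq]
  simp [algebraMap_eq]

theorem exists_rep_mk {v : Fin 3 → ℂ} (hv : v ≠ 0) :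
    ∃ c : ℂ, c ≠ 0 ∧ (Projectivization.mk ℂ v hv).rep = c • v := by
  obtain ⟨c, hc⟩ := Projectivization.exists_smul_eq_mk_rep ℂ v hv
  exact ⟨c, c.ne_zero, hc.symm⟩

theorem mk_mem_projZeroLocus {v : Fin 3 → ℂ} (hv : v ≠ 0) {n : ℕ} {G : Poly3}
    (hG : G.IsHomogeneous n) :
    Projectivization.mk ℂ v hv ∈ projZeroLocus G ↔ eval v G = 0 := by
  obtain ⟨c, hc, hr⟩ := exists_rep_mk hv
  rw [projZeroLocus, Set.mem_ofPred, hr, isHomogeneous_eval_smul hG]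
  simp [hc]

theorem isZariskiClosed_projZeroLocus {n : ℕ} {G : Poly3} (hG : G.IsHomogeneous n) :
    IsZariskiClosed (projZeroLocus G) :=
  Set.Subset.antisymm (fun _ hp => hp n G hG subset_rfl) fun _ hp _ _ _ h => h hp

theorem sends_mk (f : PlaneRatMap) {v u : Fin 3 → ℂ} (hv : v ≠ 0) (hu : u ≠ 0) {c : ℂ} (hc : c ≠ 0)
    (h : (fun i => eval v (f.coord i)) = c • u) :
    f.Sends (Projectivization.mk ℂ v hv) (Projectivization.mk ℂ u hu) := by
  obtain ⟨a, ha, hr⟩ := exists_rep_mk hv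
  have key : (fun i => eval (Projectivization.mk ℂ v hv).rep (f.coord i)) =
      (a ^ f.deg * c) • u := by
    funext i
    have := congrFun h i
    simp only [Pi.smul_apply, smul_eq_mul] at this ⊢
    rw [hr, isHomogeneous_eval_smul (f.homogeneous i), this, mul_assoc]
  have hne : a ^ f.deg * c ≠ 0 := mul_ne_zero (pow_ne_zero _ ha) hc
  refine ⟨by rw [key]; exact smul_ne_zero hne hu, ?_⟩
  rw [Projectivization.mk_eq_mk_iff']
  exact ⟨_, key.symm⟩

/-- The forms `f` have, on the cone `F = 0`, a generic left inverse given by forms `g`. -/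
def HasFormInverse (F : Poly3) (f : Fin 3 → Poly3) : Prop :=
  ∃ (e : ℕ) (g : Fin 3 → Poly3), (∀ i, (g i).IsHomogeneous e) ∧
    (∀ i j, F ∣ aeval f (g i) * X j - aeval f (g j) * X i) ∧ ∃ k, ¬ F ∣ aeval f (g k)

/-- The closure is defined by forms, so any homogeneous identity valid on the image persists on its
closure. This yields the two identities needed to go back from the closed image to the curve. -/
theorem closedImage_vanishes {F : Poly3} (f : PlaneRatMap)
    {n : ℕ} {K : Poly3} (hK : K.IsHomogeneous n)
    (h : ∀ v, v ≠ 0 → eval v F = 0 → eval (fun i => eval v (f.coord i)) K = 0)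
    {u : Fin 3 → ℂ} (hu : u ≠ 0)
    (hmem : Projectivization.mk ℂ u hu ∈ f.closedImage (projZeroLocus F)) : eval u K = 0 := by
  rw [← mk_mem_projZeroLocus hu hK]
  refine hmem n K hK ?_
  rintro q ⟨p, hp, h0, rfl⟩
  rw [mk_mem_projZeroLocus h0 hK]
  exact h _ p.rep_nonzero hp

theorem isBirationalOn_of_hasFormInverse {F : Poly3} {d : ℕ} (hF : F.IsHomogeneous d)
    (hFp : Prime F) (hX : ¬ F ∣ X 0) (f : PlaneRatMap) (hf : ∃ l, ¬ F ∣ f.coord l)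
    (hinv : HasFormInverse F f.coord) : f.IsBirationalOn (projZeroLocus F) := by
  obtain ⟨e, g, hg, hgX, k, hk⟩ := hinv
  obtain ⟨l, hl⟩ := hf
  let gm : PlaneRatMap := ⟨g, e, hg⟩
  have hgf : ∀ v, v ≠ 0 → eval v F = 0 →
      ∃ c : ℂ, (fun i => eval (fun j => eval v (f.coord j)) (g i)) = c • v := by
    intro v hv hFv
    refine exists_eq_smul_of_mul_comm hv fun i j => ?_
    obtain ⟨K, hK⟩ := hgX i j
    have := congrArg (eval v) hK
    simp only [map_sub, map_mul, eval_X, hFv, zero_mul, eval_aeval_poly] at this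
    linear_combination this
  -- The two open sets match: if `g(f(v)) = c v`, then `f_l(g(f(v)))` is a power of `c` times
  -- `f_l(v)`, and symmetrically for `f` after `g`.
  set GZ : Poly3 := aeval f.coord (g k) * f.coord l with hGZ
  set GW : Poly3 := g k * aeval g (f.coord l) with hGW
  have hGZh : GZ.IsHomogeneous _ := ((hg k).aeval f.coord f.homogeneous).mul (f.homogeneous l)
  have hGWh : GW.IsHomogeneous _ := (hg k).mul ((f.homogeneous l).aeval g hg)
  have fwd : ∀ v (hv : v ≠ 0), eval v F = 0 → eval v GZ ≠ 0 →
      ∃ q ∈ f.closedImage (projZeroLocus F) \ projZeroLocus GW,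
        f.Sends (Projectivization.mk ℂ v hv) q ∧ gm.Sends q (Projectivization.mk ℂ v hv) := by
    intro v hv hFv hG
    rw [hGZ, map_mul, eval_aeval_poly] at hG
    have h1 := left_ne_zero_of_mul hG
    have h2 := right_ne_zero_of_mul hG
    have hu : (fun i => eval v (f.coord i)) ≠ 0 := fun h => h2 (congrFun h l)
    obtain ⟨c, hc⟩ := hgf v hv hFv
    have hc0 : c ≠ 0 := by
      rintro rfl
      exact h1 (by simpa using congrFun hc k)
    have hs : f.Sends (Projectivization.mk ℂ v hv) (Projectivization.mk ℂ _ hu) :=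
      sends_mk f hv hu one_ne_zero (by rw [one_smul])
    refine ⟨Projectivization.mk ℂ _ hu, ⟨?_, ?_⟩, hs, ?_⟩
    · intro n K hK hsub
      exact hsub ⟨_, (mk_mem_projZeroLocus hv hF).2 hFv, hs⟩
    · rw [mk_mem_projZeroLocus hu hGWh, hGW, map_mul, eval_aeval_poly, hc,
        isHomogeneous_eval_smul (f.homogeneous l)]
      exact mul_ne_zero h1 (mul_ne_zero (pow_ne_zero _ hc0) h2)
    · exact sends_mk gm hu hv hc0 hc
  have hpt : ∃ v, v ≠ 0 ∧ eval v F = 0 ∧ eval v GZ ≠ 0 := by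
    -- The factor `X 0` only serves to make the zero found a nonzero vector.
    have : ¬ F ∣ GZ * X 0 := by
      intro h
      rcases hFp.dvd_or_dvd h with h | h
      · rcases hFp.dvd_or_dvd h with h | h
        · exact hk h
        · exact hl h
      · exact hX h
    obtain ⟨v, hv, hne⟩ := exists_zero_eval_ne_zero hFp this
    rw [map_mul, eval_X] at hne
    exact ⟨v, fun h => right_ne_zero_of_mul hne (congrFun h 0), hv, left_ne_zero_of_mul hne⟩
  have hlift : ∀ p : P2, ∃ v, ∃ hv : v ≠ 0, p = Projectivization.mk ℂ v hv :=
    fun p => ⟨p.rep, p.rep_nonzero, p.mk_rep.symm⟩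
  refine ⟨gm, projZeroLocus GZ, projZeroLocus GW, isZariskiClosed_projZeroLocus hGZh,
    isZariskiClosed_projZeroLocus hGWh, ?_, ?_, ?_, ?_⟩
  · obtain ⟨v, hv, h1, h2⟩ := hpt
    exact ⟨Projectivization.mk ℂ v hv, (mk_mem_projZeroLocus hv hF).2 h1,
      fun h => h2 ((mk_mem_projZeroLocus hv hGZh).1 h)⟩
  · obtain ⟨v, hv, h1, h2⟩ := hpt
    obtain ⟨q, hq, -⟩ := fwd v hv h1 h2
    exact ⟨q, hq⟩
  · rintro p ⟨hp1, hp2⟩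
    obtain ⟨v, hv, rfl⟩ := hlift p
    exact fwd v hv ((mk_mem_projZeroLocus hv hF).1 hp1)
      fun h => hp2 ((mk_mem_projZeroLocus hv hGZh).2 h)
  · rintro q ⟨hq1, hq2⟩
    obtain ⟨u, hu, rfl⟩ := hlift q
    rw [mk_mem_projZeroLocus hu hGWh, hGW, map_mul, eval_aeval_poly] at hq2
    have h1 := left_ne_zero_of_mul hq2
    have h2 := right_ne_zero_of_mul hq2
    set v : Fin 3 → ℂ := fun i => eval u (g i) with hvdef
    have hv : v ≠ 0 := fun h => h1 (congrFun h k)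
    have hFv : eval v F = 0 := by
      have := closedImage_vanishes f (hF.aeval g hg) (fun z hz hFz => by
        obtain ⟨c, hc⟩ := hgf z hz hFz
        rw [eval_aeval_poly, hc, isHomogeneous_eval_smul hF, hFz, mul_zero]) hu hq1
      rwa [eval_aeval_poly] at this
    obtain ⟨c, hc⟩ : ∃ c : ℂ, (fun i => eval v (f.coord i)) = c • u := by
      refine exists_eq_smul_of_mul_comm hu fun i j => ?_
      have := closedImage_vanishes f (K := aeval g (f.coord i) * X j - aeval g (f.coord j) * X i)
        ((((f.homogeneous i).aeval g hg).mul (isHomogeneous_X ℂ j)).sub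
          (((f.homogeneous j).aeval g hg).mul (isHomogeneous_X ℂ i))) (fun z hz hFz => by
        obtain ⟨c, hc⟩ := hgf z hz hFz
        simp only [map_sub, map_mul, eval_X, eval_aeval_poly, hc,
          isHomogeneous_eval_smul (f.homogeneous _)]
        ring) hu hq1
      simp only [map_sub, map_mul, eval_X, eval_aeval_poly] at this
      linear_combination this
    have hc0 : c ≠ 0 := by
      rintro rfl
      exact h2 (by simpa using congrFun hc l)
    refine ⟨Projectivization.mk ℂ v hv, ⟨(mk_mem_projZeroLocus hv hF).2 hFv, ?_⟩, ?_, ?_⟩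
    · rw [mk_mem_projZeroLocus hv hGZh, hGZ, map_mul, eval_aeval_poly, hc,
        isHomogeneous_eval_smul (hg k)]
      exact mul_ne_zero (mul_ne_zero (pow_ne_zero _ hc0) h1) h2
    · exact sends_mk gm hu hv one_ne_zero (by rw [one_smul])
    · exact sends_mk f hv hu hc0 hc

/-! ### Cross products, linear forms and translations -/

theorem mul_cross_comm {A : Type*} [CommRing A] {a b w : Fin 3 → A} (h1 : w ⬝ᵥ a = 0)
    (h2 : w ⬝ᵥ b = 0) (i j : Fin 3) : w i * (a ⨯₃ b) j = w j * (a ⨯₃ b) i := by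
  simp only [dotProduct, Fin.sum_univ_three] at h1 h2
  fin_cases i <;> fin_cases j <;> simp [cross_apply] <;> grind

/-- The triple product expansion. Its typical use: if `a × b = 0`, `b·c = 0` and `a·c ≠ 0`, then `b
= 0`. -/
theorem dot_mul_sub_dot_mul {A : Type*} [CommRing A] (a b c : Fin 3 → A) (i : Fin 3) :
    (a ⬝ᵥ c) * b i = (b ⬝ᵥ c) * a i + ((a ⨯₃ b) ⨯₃ c) i := by
  simp only [dotProduct, Fin.sum_univ_three]
  fin_cases i <;> simp [cross_apply] <;> ring

/-- Both `u` and `v` are parallel to the nonzero vector `a × b`. -/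
theorem mul_comm_of_orthogonal {A : Type*} [CommRing A] [IsDomain A] {a b u v : Fin 3 → A}
    (hab : a ⨯₃ b ≠ 0) (hua : u ⬝ᵥ a = 0) (hub : u ⬝ᵥ b = 0) (hva : v ⬝ᵥ a = 0)
    (hvb : v ⬝ᵥ b = 0) (i j : Fin 3) : u i * v j = u j * v i := by
  obtain ⟨k, hk⟩ := Function.ne_iff.1 hab
  have h1 := mul_cross_comm hua hub
  have h2 := mul_cross_comm hva hvb
  refine mul_left_cancel₀ (mul_ne_zero hk hk) ?_
  have e1 := h1 i k
  have e2 := h2 j k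
  have e3 := h1 j k
  have e4 := h2 i k
  set c := (a ⨯₃ b)
  calc c k * c k * (u i * v j) = (u i * c k) * (v j * c k) := by ring
    _ = (u j * c k) * (v i * c k) := by rw [e1, e2, e3, e4]; ring
    _ = _ := by ring

theorem exists_ne_zero_orthogonal (v : Fin 3 → ℂ) : ∃ h : Fin 3 → ℂ, h ≠ 0 ∧ h ⬝ᵥ v = 0 := by
  by_cases h : v 0 = 0 ∧ v 1 = 0
  · exact ⟨![1, 0, 0], fun h => by simpa using congrFun h 0, by
      simp [dotProduct, Fin.sum_univ_three, h.1]⟩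
  · refine ⟨![v 1, -v 0, 0], fun h' => h ⟨?_, ?_⟩, ?_⟩
    · simpa using congrFun h' 1
    · simpa using congrFun h' 0
    · simp [dotProduct, Fin.sum_univ_three]; ring

/-- The linear form with coefficients `u`. -/
noncomputable def linForm (u : Fin 3 → ℂ) : Poly3 := ∑ i, C (u i) * X i

theorem eval_linForm (u z : Fin 3 → ℂ) : eval z (linForm u) = u ⬝ᵥ z := by
  simp [linForm, dotProduct]

theorem isHomogeneous_linForm (u : Fin 3 → ℂ) : (linForm u).IsHomogeneous 1 :=
  IsHomogeneous.sum _ _ _ fun i _ => isHomogeneous_C_mul_X _ i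

theorem linForm_ne_zero {u : Fin 3 → ℂ} (hu : u ≠ 0) : linForm u ≠ 0 := by
  classical
  intro h
  refine hu (funext fun i => ?_)
  have := eval_linForm u (Pi.single i 1)
  simpa [h] using this.symm

theorem irreducible_linForm {u : Fin 3 → ℂ} (hu : u ≠ 0) : Irreducible (linForm u) := by
  have h0 := linForm_ne_zero hu
  refine irreducible_of_totalDegree_eq_one ((isHomogeneous_linForm u).totalDegree h0) ?_
  intro x hx
  refine isUnit_iff_ne_zero.2 ?_
  rintro rfl
  exact h0 (MvPolynomial.ext _ _ fun m => by simpa using hx m)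

/-- Along a line of direction `v` the derivative of `F` is its polar, and a polynomial in one
variable with zero derivative is constant in characteristic zero. -/
theorem eval_add_smul_of_polar_eq_zero {F : Poly3} {v : Fin 3 → ℂ}
    (h : ∑ i, C (v i) * pderiv i F = 0) (a : Fin 3 → ℂ) (t : ℂ) :
    eval (a + t • v) F = eval a F := by
  let b : Fin 3 → Polynomial ℂ := fun i => Polynomial.C (a i) + Polynomial.C (v i) * Polynomial.X
  have hd : Polynomial.derivative (aeval b F) = 0 := by
    have h1 := derivation_aeval (Polynomial.derivative' (R := ℂ)) b F
    have h2 := congrArg (aeval b) h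
    simp only [map_sum, map_mul, map_zero, aeval_C] at h2
    simp only [Polynomial.derivative'_apply] at h1
    rw [h1, ← h2]
    refine Finset.sum_congr rfl fun i _ => ?_
    simp only [b, Polynomial.derivative_add, Polynomial.derivative_C, Polynomial.derivative_mul,
      Polynomial.derivative_X, Polynomial.algebraMap_eq]
    ring
  have hc := Polynomial.eq_C_of_natDegree_eq_zero
    (Polynomial.derivative_eq_zero.1 hd)
  have hev : ∀ t : ℂ, Polynomial.eval t (aeval b F) = eval (a + t • v) F := by
    intro t
    rw [← Polynomial.coe_evalRingHom, map_aeval]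
    simp only [coe_eval₂Hom, eval, eval₂_eq]
    simp [b, smul_eq_mul, Polynomial.algebraMap_eq, mul_comm t]
  have e0 := hev 0
  rw [← hev t, hc, Polynomial.eval_C]
  rw [hc, Polynomial.eval_C] at e0
  simpa using e0

/-! ### Polars of an irreducible curve -/

section Curve

variable {F : Poly3} {d : ℕ}

theorem not_dvd_of_lt_degree (hF : F.IsHomogeneous d) (hF0 : F ≠ 0) {G : Poly3} {n : ℕ}
    (hG : G.IsHomogeneous n) (hG0 : G ≠ 0) (hn : n < d) : ¬ F ∣ G := by
  intro h
  have := totalDegree_le_of_dvd_of_isDomain h hG0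
  rw [hF.totalDegree hF0, hG.totalDegree hG0] at this
  omega

theorem not_dvd_linForm (hd : 2 ≤ d) (hF : F.IsHomogeneous d) (hF0 : F ≠ 0) {u : Fin 3 → ℂ}
    (hu : u ≠ 0) : ¬ F ∣ linForm u :=
  not_dvd_of_lt_degree hF hF0 (isHomogeneous_linForm u) (linForm_ne_zero hu) (by omega)

/-- An irreducible curve of degree at least two is not a cone. -/
theorem polar_ne_zero (hd : 2 ≤ d) (hF : F.IsHomogeneous d) (hirr : Irreducible F)
    {v : Fin 3 → ℂ} (hv : v ≠ 0) : ∑ i, C (v i) * pderiv i F ≠ 0 := by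
  intro hpol
  obtain ⟨h, hh0, hhv⟩ := exists_ne_zero_orthogonal v
  obtain ⟨a, hFa, hha⟩ := exists_zero_eval_ne_zero hirr.prime
    (not_dvd_linForm hd hF hirr.ne_zero hh0)
  rw [eval_linForm] at hha
  -- The line joining `v` to a point `a` of the curve. Translation by `v` preserves `F`, so this
  -- whole line lies in the curve, which contradicts irreducibility in degree at least two.
  set l : Fin 3 → ℂ := a ⨯₃ v with hl
  have hla : l ⬝ᵥ a = 0 := by rw [dotProduct_comm]; exact dot_self_cross a v
  have hlv : l ⬝ᵥ v = 0 := by rw [dotProduct_comm]; exact dot_cross_self a v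
  have hl0 : l ≠ 0 := by
    intro h0
    apply hv
    have e : ∀ i, (h ⬝ᵥ a) * v i = (h ⬝ᵥ v) * a i - (h ⨯₃ l) i := by
      intro i
      simp only [hl, dotProduct, Fin.sum_univ_three]
      fin_cases i <;> simp [cross_apply] <;> ring
    funext i
    have := e i
    rw [h0, hhv] at this
    simpa [hha] using this
  have hcr : h ⨯₃ l ≠ 0 := by
    intro h0
    apply hl0
    funext i
    have := dot_mul_sub_dot_mul h l a i
    rw [h0, hla] at this
    simpa [hha] using this
  have hdvd : linForm l ∣ F := by
    refine dvd_of_vanishes_on_zeros (irreducible_linForm hl0).prime fun z hz => ?_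
    rw [eval_linForm] at hz
    -- With this `c`, the vector `z - c a` is orthogonal to both `h` and `l`, hence a multiple of
    -- `v`.
    set c := (h ⬝ᵥ z) / (h ⬝ᵥ a) with hc
    have hz1 : (z - c • a) ⬝ᵥ h = 0 := by
      rw [dotProduct_comm, dotProduct_sub, dotProduct_smul, smul_eq_mul, hc]
      field_simp
      ring
    have hz2 : (z - c • a) ⬝ᵥ l = 0 := by
      rw [dotProduct_comm, dotProduct_sub, dotProduct_smul, hz, hla]; simp
    obtain ⟨t, ht⟩ := exists_eq_smul_of_mul_comm hv
      (mul_comm_of_orthogonal hcr hz1 hz2 (by rwa [dotProduct_comm]) (by rwa [dotProduct_comm]))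
    have hz' : z = c • a + t • v := by rw [← ht]; abel
    rw [hz', eval_add_smul_of_polar_eq_zero hpol, isHomogeneous_eval_smul hF, hFa, mul_zero]
  exact not_dvd_linForm hd hF hirr.ne_zero hl0
    ((irreducible_linForm hl0).dvd_symm hirr hdvd)

theorem not_dvd_polar (hd : 2 ≤ d) (hF : F.IsHomogeneous d) (hirr : Irreducible F)
    {v : Fin 3 → ℂ} (hv : v ≠ 0) : ¬ F ∣ ∑ i, C (v i) * pderiv i F := by
  refine not_dvd_of_lt_degree hF hirr.ne_zero (n := d - 1) ?_ (polar_ne_zero hd hF hirr hv)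
    (by omega)
  exact IsHomogeneous.sum _ _ _ fun i _ => hF.pderiv.C_mul _

theorem not_dvd_pderiv (hd : 2 ≤ d) (hF : F.IsHomogeneous d) (hirr : Irreducible F) (i : Fin 3) :
    ¬ F ∣ pderiv i F := by
  have := not_dvd_polar hd hF hirr (v := Pi.single i 1) (by simp)
  simpa [Pi.single_apply, apply_ite, ite_mul] using this

/-- Over `ℂ` the sum of squares is the product of the polars of the two circular points `(1, ±i,
0)`. -/
theorem not_dvd_sq_add_sq (hd : 2 ≤ d) (hF : F.IsHomogeneous d) (hirr : Irreducible F) :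
    ¬ F ∣ pderiv 0 F ^ 2 + pderiv 1 F ^ 2 := by
  have hI : (C Complex.I : Poly3) * C Complex.I = -1 := by rw [← C_mul, Complex.I_mul_I]; simp
  have e : pderiv 0 F ^ 2 + pderiv 1 F ^ 2 =
      (∑ i, C ((![1, Complex.I, 0] : Fin 3 → ℂ) i) * pderiv i F) *
        (∑ i, C ((![1, -Complex.I, 0] : Fin 3 → ℂ) i) * pderiv i F) := by
    simp only [Fin.sum_univ_three, Matrix.cons_val, map_one, map_zero, map_neg]
    linear_combination (pderiv 1 F ^ 2) * hI
  rw [e]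
  intro h
  rcases hirr.prime.dvd_or_dvd h with h | h
  · exact not_dvd_polar hd hF hirr (fun h => by simpa using congrFun h 0) h
  · exact not_dvd_polar hd hF hirr (fun h => by simpa using congrFun h 0) h

end Curve

/-- Off a homogeneous hypersurface, every line through the origin leaves the hypersurface
`G = 0`. -/
theorem exists_homogeneous_of_scaling {G : Poly3} (hG : G ≠ 0) :
    ∃ (n : ℕ) (K : Poly3), K.IsHomogeneous n ∧ K ≠ 0 ∧
      ∀ s : Fin 3 → ℂ, eval s K ≠ 0 → ∃ c : ℂ, c ≠ 0 ∧ eval (c • s) G ≠ 0 := by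
  obtain ⟨n, hn⟩ : ∃ n, homogeneousComponent n G ≠ 0 := by
    by_contra! hc
    apply hG
    rw [← sum_homogeneousComponent G]
    simp [hc]
  refine ⟨n, homogeneousComponent n G, homogeneousComponent_isHomogeneous n G, hn, ?_⟩
  intro s hs
  by_contra! hc
  let p : Polynomial ℂ := ∑ m ∈ Finset.range (G.totalDegree + 1),
    Polynomial.C (eval s (homogeneousComponent m G)) * Polynomial.X ^ m
  have hpe : ∀ c, p.eval c = eval (c • s) G := by
    intro c
    conv_rhs => rw [← sum_homogeneousComponent G]
    simp only [p, Polynomial.eval_finsetSum, Polynomial.eval_mul, Polynomial.eval_C,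
      Polynomial.eval_pow, Polynomial.eval_X, map_sum]
    refine Finset.sum_congr rfl fun m _ => ?_
    rw [isHomogeneous_eval_smul (homogeneousComponent_isHomogeneous m G), mul_comm]
  -- The vanishing is known only for `c ≠ 0`; the factor `X` covers `c = 0`.
  have hp : Polynomial.X * p = 0 := by
    refine Polynomial.funext fun c => ?_
    by_cases h : c = 0
    · simp [h]
    · simp [hpe, hc c h]
  have hp0 : p = 0 := by simpa using hp
  have := congrArg (fun P => Polynomial.coeff P n) hp0
  simp only [p, Polynomial.finsetSum_coeff, Polynomial.coeff_C_mul, Polynomial.coeff_X_pow,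
    Polynomial.coeff_zero] at this
  by_cases hnr : n ∈ Finset.range (G.totalDegree + 1)
  · rw [Finset.sum_eq_single n (fun m _ hm => by simp [hm.symm]) (fun h => absurd hnr h)] at this
    exact hs (by simpa using this)
  · exact hn (homogeneousComponent_eq_zero _ _ (by simpa using hnr))

/-! ### Algebra of the reflection in the tangent -/

section LinearAlgebra

variable {A : Type*} [CommRing A]

theorem orthSymm_apply (t v : Fin 3 → A) (i : Fin 3) :
    orthSymm t v i = (t 0 ^ 2 + t 1 ^ 2) * v i -
      2 * (t 0 * v 0 + t 1 * v 1 + t 2 * v 2) * (![t 0, t 1, 0] : Fin 3 → A) i := by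
  simp only [orthSymm, dotProduct, Fin.sum_univ_three, Pi.sub_apply, Pi.smul_apply, smul_eq_mul]

theorem orthSymm_orthSymm (t v : Fin 3 → A) :
    orthSymm t (orthSymm t v) = (t 0 ^ 2 + t 1 ^ 2) ^ 2 • v := by
  funext i
  fin_cases i <;> simp [orthSymm_apply] <;> ring

theorem orthSymm_of_orthogonal {t v : Fin 3 → A} (h : t ⬝ᵥ v = 0) :
    orthSymm t v = (t 0 ^ 2 + t 1 ^ 2) • v := by
  simp [orthSymm, h]

/-- Geometrically, the reflected line passes through the source only when the source is on the
tangent or on the normal. -/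
theorem cross_orthSymm_dot (x t s : Fin 3 → A) :
    (x ⨯₃ orthSymm t s) ⬝ᵥ s = -2 * (t ⬝ᵥ s) * ((x ⨯₃ ![t 0, t 1, 0]) ⬝ᵥ s) := by
  simp [orthSymm_apply, dotProduct, Fin.sum_univ_three, cross_apply]
  ring

theorem cross_orthSymm_dot_tangent {x t : Fin 3 → A} (h : x ⬝ᵥ t = 0) (s : Fin 3 → A) :
    ![-t 1, t 0, 0] ⬝ᵥ (x ⨯₃ orthSymm t s) = -x 2 * (t 0 ^ 2 + t 1 ^ 2) * (t ⬝ᵥ s) := by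
  simp [orthSymm_apply, dotProduct, Fin.sum_univ_three, cross_apply] at h ⊢
  linear_combination (-s 2 * (t 0 ^ 2 + t 1 ^ 2)) * h

/-- The vectors `r × l` recover the point `x` from the reflected line `r = x × σ(s)`, where `w` and
`l` play the role of the derivatives of the equation of the dual caustic in the line and in
the light position. -/
theorem cross_reflected_ne_zero [IsDomain A] (h2 : (2 : A) ≠ 0) {x t s w l r : Fin 3 → A}
    (hxt : x ⬝ᵥ t = 0) (hN : t 0 ^ 2 + t 1 ^ 2 ≠ 0) (hx : x 2 ≠ 0) (hts : t ⬝ᵥ s ≠ 0)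
    (hns : (x ⨯₃ ![t 0, t 1, 0]) ⬝ᵥ s ≠ 0) (hw : w ≠ 0)
    (hwr : w ⬝ᵥ (x ⨯₃ orthSymm t s) = 0) (hwr' : w ⬝ᵥ r = 0)
    (hr : ![-t 1, t 0, 0] ⬝ᵥ (x ⨯₃ orthSymm t s) + x ⬝ᵥ r = 0)
    (hl : ∀ v, l ⬝ᵥ v + w ⬝ᵥ (x ⨯₃ orthSymm t v) = 0) :
    (x ⨯₃ orthSymm t s) ⨯₃ l ≠ 0 := by
  intro h0
  have hls : l ⬝ᵥ s = 0 := by simpa [hwr] using hl s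
  -- If `r × l = 0`, then `l` is parallel to the reflected line, which does not contain `s`, whereas
  -- `l·s = 0`.
  have hl0 : l = 0 := by
    funext i
    have := dot_mul_sub_dot_mul (x ⨯₃ orthSymm t s) l s i
    rw [h0, hls, cross_orthSymm_dot] at this
    simpa [h2, hts, hns] using this
  -- The symmetry is an involution up to the nonzero factor `(t 0 ^ 2 + t 1 ^ 2) ^ 2`, so `orthSymm
  -- t v` may replace `v`.
  have hwx : ∀ v, w ⬝ᵥ (x ⨯₃ v) = 0 := by
    intro v
    have := hl (orthSymm t v)
    rw [hl0, orthSymm_orthSymm] at this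
    simpa [hN] using this
  have hxr : x ⬝ᵥ r = 0 := by
    obtain ⟨k, hk⟩ := Function.ne_iff.1 hw
    have hpar : ∀ j, w k * x j = w j * x k := by
      intro j
      have e0 := hwx (Pi.single 0 1)
      have e1 := hwx (Pi.single 1 1)
      have e2 := hwx (Pi.single 2 1)
      simp [dotProduct, Fin.sum_univ_three, cross_apply] at e0 e1 e2
      fin_cases k <;> fin_cases j <;> simp <;> grind
    refine (mul_eq_zero.1 (?_ : w k * (x ⬝ᵥ r) = 0)).resolve_left hk
    calc w k * (x ⬝ᵥ r) = x k * (w ⬝ᵥ r) := by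
          simp only [dotProduct, Fin.sum_univ_three]
          linear_combination r 0 * hpar 0 + r 1 * hpar 1 + r 2 * hpar 2
      _ = 0 := by rw [hwr', mul_zero]
  rw [hxr, add_zero, cross_orthSymm_dot_tangent hxt] at hr
  simp [hx, hN, hts] at hr

/-- Both factors are orthogonal to `x`: for `l`, take `v = x` in `hl`, since the symmetry fixes
points of the tangent up to a scalar. -/
theorem cross_reflected_mul_comm {x t s w l : Fin 3 → A} (hxt : x ⬝ᵥ t = 0)
    (hl : ∀ v, l ⬝ᵥ v + w ⬝ᵥ (x ⨯₃ orthSymm t v) = 0) (i j : Fin 3) :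
    x i * ((x ⨯₃ orthSymm t s) ⨯₃ l) j = x j * ((x ⨯₃ orthSymm t s) ⨯₃ l) i := by
  refine mul_cross_comm (dot_self_cross _ _) ?_ i j
  have := hl x
  rw [orthSymm_of_orthogonal (by rwa [dotProduct_comm])] at this
  rw [dotProduct_comm]
  simpa using this

end LinearAlgebra

/-! ### Compatibility with ring homomorphisms -/

section Maps

variable {A B : Type*} [CommRing A] [CommRing B]

theorem map_cross_apply (φ : A →+* B) (u v : Fin 3 → A) (i : Fin 3) :
    φ ((u ⨯₃ v) i) = ((fun j => φ (u j)) ⨯₃ (fun j => φ (v j))) i := by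
  fin_cases i <;> simp [cross_apply]

theorem map_dot (φ : A →+* B) (u v : Fin 3 → A) :
    φ (u ⬝ᵥ v) = (fun j => φ (u j)) ⬝ᵥ (fun j => φ (v j)) := by
  simp [dotProduct]

theorem map_orthSymm_apply (φ : A →+* B) (t v : Fin 3 → A) (i : Fin 3) :
    φ (orthSymm t v i) = orthSymm (fun j => φ (t j)) (fun j => φ (v j)) i := by
  fin_cases i <;> simp [orthSymm_apply, map_ofNat φ 2]

theorem map_cross_orthSymm_apply (φ : A →+* B) (x t v : Fin 3 → A) (i : Fin 3) :
    φ ((x ⨯₃ orthSymm t v) i) =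
      ((fun j => φ (x j)) ⨯₃ orthSymm (fun j => φ (t j)) (fun j => φ (v j))) i := by
  rw [map_cross_apply]
  simp only [map_orthSymm_apply]

end Maps

/-! ### The family of reflected lines over all light positions -/

/-- Polynomials in a light position (the variables `inl`) and a point (the variables `inr`). -/
abbrev Poly6 : Type := MvPolynomial (Fin 3 ⊕ Fin 3) ℂ

/-- Viewed as polynomials in the light with coefficients in `Poly3`, the renamed `F` is a constant,
and a prime constant stays prime. -/
theorem prime_rename_inr {F : Poly3} (hF : Prime F) :
    Prime (rename Sum.inr F : Poly6) := by
  have h : ((sumRingEquiv ℂ (Fin 3) (Fin 3)).toRingHom.comp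
      (rename Sum.inr : Poly3 →ₐ[ℂ] Poly6).toRingHom) = C :=
    ringHom_ext (fun r => by simp) fun i => by simp
  rw [← MulEquiv.prime_iff (sumRingEquiv ℂ (Fin 3) (Fin 3)).toMulEquiv]
  have hF' : sumRingEquiv ℂ (Fin 3) (Fin 3) (rename Sum.inr F) = C F := DFunLike.congr_fun h F
  exact hF'.symm ▸ (prime_C_iff (Fin 3)).2 hF

/-- Specialization of the light position. -/
noncomputable def lightAt (s : Fin 3 → ℂ) : Poly6 →ₐ[ℂ] Poly3 :=
  aeval (Sum.elim (fun i => C (s i)) X)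

/-- Specialization of the point. -/
noncomputable def pointAt (m : Fin 3 → ℂ) : Poly6 →ₐ[ℂ] Poly3 :=
  aeval (Sum.elim X (fun i => C (m i)))

@[simp]
theorem lightAt_X_inl (s : Fin 3 → ℂ) (i : Fin 3) : lightAt s (X (Sum.inl i)) = C (s i) := by
  simp [lightAt]

@[simp]
theorem lightAt_X_inr (s : Fin 3 → ℂ) (i : Fin 3) : lightAt s (X (Sum.inr i)) = X i := by
  simp [lightAt]

@[simp]
theorem lightAt_rename (s : Fin 3 → ℂ) (G : Poly3) : lightAt s (rename Sum.inr G) = G := by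
  rw [lightAt, aeval_rename]
  exact aeval_X_left_apply G

theorem eval_lightAt (s m : Fin 3 → ℂ) (G : Poly6) :
    eval m (lightAt s G) = eval (Sum.elim s m) G := by
  rw [lightAt, eval_aeval_poly]
  congr 2
  ext j
  cases j <;> simp

theorem eval_pointAt (s m : Fin 3 → ℂ) (G : Poly6) :
    eval s (pointAt m G) = eval (Sum.elim s m) G := by
  rw [pointAt, eval_aeval_poly]
  congr 2
  ext j
  cases j <;> simp

/-- The reflected line, as a function of the light position and the point. -/
noncomputable def rhoFamily (F : Poly3) : Fin 3 → Poly6 :=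
  (fun i => X (Sum.inr i)) ⨯₃
    orthSymm (fun i => rename Sum.inr (pderiv i F)) (fun i => X (Sum.inl i))

theorem lightAt_rhoFamily (F : Poly3) (s : Fin 3 → ℂ) (i : Fin 3) :
    lightAt s (rhoFamily F i) = rhoCoord F s i := by
  have := map_cross_orthSymm_apply (lightAt s : Poly6 →+* Poly3) (fun i => X (Sum.inr i))
    (fun i => rename Sum.inr (pderiv i F)) (fun i => X (Sum.inl i)) i
  simp only [RingHom.coe_coe, lightAt_X_inl, lightAt_X_inr, lightAt_rename] at this
  exact this

/-- The substitution of the reflected line for the point. -/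
noncomputable def reflSubst (F : Poly3) : Fin 3 ⊕ Fin 3 → Poly6 :=
  Sum.elim (fun i => X (Sum.inl i)) (rhoFamily F)

/-- The derivation along `V(F)` in the chart `z = 1`, for a fixed light position. -/
noncomputable def tangentDerivation (F : Poly3) : Derivation ℂ Poly6 Poly6 :=
  (rename Sum.inr (pderiv 0 F) : Poly6) • pderiv (Sum.inr 1) -
    (rename Sum.inr (pderiv 1 F) : Poly6) • pderiv (Sum.inr 0)

theorem tangentDerivation_apply (F : Poly3) (G : Poly6) : tangentDerivation F G =
    rename Sum.inr (pderiv 0 F) * pderiv (Sum.inr 1) G -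
      rename Sum.inr (pderiv 1 F) * pderiv (Sum.inr 0) G := rfl

theorem pderiv_inl_rename_inr (j : Fin 3) (G : Poly3) :
    pderiv (Sum.inl j) (rename Sum.inr G : Poly6) = 0 := by
  classical
  refine pderiv_eq_zero_of_notMem_vars fun h => ?_
  have := vars_rename Sum.inr G h
  simp at this

/-- The reflected line is linear in the light, so its partial derivatives are its values at the
basis vectors. -/
theorem pderiv_inl_rhoFamily (F : Poly3) (j i : Fin 3) : pderiv (Sum.inl j) (rhoFamily F i) =
    ((fun i => X (Sum.inr i)) ⨯₃
      orthSymm (fun i => (rename Sum.inr (pderiv i F) : Poly6)) (Pi.single j 1)) i := by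
  classical
  have h2 : ∀ k, pderiv (Sum.inl k) (2 : Poly6) = 0 := fun k => by
    exact_mod_cast (pderiv (Sum.inl k) : Derivation ℂ Poly6 Poly6).map_natCast 2
  fin_cases i <;> fin_cases j <;>
    simp [rhoFamily, cross_apply, orthSymm_apply, Derivation.leibniz, pderiv_inl_rename_inr,
      pderiv_X, h2, Derivation.leibniz_pow] <;> ring

/-! ### Inverting the family of reflected lines -/

section Family

variable {F : Poly3} {d : ℕ}

/-- The weights for which the degree in the point is measured. -/
def pointWeight : Fin 3 ⊕ Fin 3 → ℕ := Sum.elim 0 1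

theorem eval_rhoFamily (F : Poly3) (z : Fin 3 ⊕ Fin 3 → ℂ) (i : Fin 3) :
    eval z (rhoFamily F i) =
      eval (fun j => z (Sum.inr j)) (rhoCoord F (fun j => z (Sum.inl j)) i) := by
  rw [← lightAt_rhoFamily, eval_lightAt]
  congr 2
  exact (Sum.elim_comp_inl_inr z).symm

theorem scale_pointWeight_inr (c : ℂ) (z : Fin 3 ⊕ Fin 3 → ℂ) :
    (fun j => c ^ pointWeight (Sum.inr j) * z (Sum.inr j)) = c • fun j => z (Sum.inr j) := by
  ext j; simp [pointWeight]

theorem scale_pointWeight_inl (c : ℂ) (z : Fin 3 ⊕ Fin 3 → ℂ) :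
    (fun j => c ^ pointWeight (Sum.inl j) * z (Sum.inl j)) = fun j => z (Sum.inl j) := by
  ext j; simp [pointWeight]

theorem eval_reflSubst_scale (hF : F.IsHomogeneous d) (c : ℂ) (z : Fin 3 ⊕ Fin 3 → ℂ)
    (j : Fin 3 ⊕ Fin 3) : eval (fun i => c ^ pointWeight i * z i) (reflSubst F j) =
      (c ^ (1 + ((d - 1) + (d - 1)))) ^ pointWeight j * eval z (reflSubst F j) := by
  cases j with
  | inl j => simp [reflSubst, pointWeight]
  | inr j =>
    simp only [reflSubst, Sum.elim_inr, eval_rhoFamily, scale_pointWeight_inr,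
      scale_pointWeight_inl]
    rw [isHomogeneous_eval_smul (isHomogeneous_rhoCoord hF _ j)]
    simp [pointWeight]

theorem eval_rename_inr_scale (hF : F.IsHomogeneous d) (c : ℂ) (z : Fin 3 ⊕ Fin 3 → ℂ)
    (h : eval z (rename Sum.inr F) = 0) :
    eval (fun i => c ^ pointWeight i * z i) (rename Sum.inr F) = 0 := by
  rw [eval_rename] at h ⊢
  have : ((fun i => c ^ pointWeight i * z i) ∘ Sum.inr) = c • (z ∘ Sum.inr) :=
    scale_pointWeight_inr c z
  rw [this, isHomogeneous_eval_smul hF, h, mul_zero]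

/-- A relation of weight zero involves the light alone. Evaluating at the apex of the cone, where
the point coordinates and hence `F` vanish, shows that it is zero at every light position. -/
theorem eq_zero_of_dvd_aeval_reflSubst (hd : 2 ≤ d) (hF : F.IsHomogeneous d) {H : Poly6}
    (hH : H.IsWeightedHomogeneous pointWeight 0)
    (hdvd : rename Sum.inr F ∣ aeval (reflSubst F) H) : H = 0 := by
  refine MvPolynomial.funext fun z => ?_
  have h1 : eval (fun i => (0 : ℂ) ^ pointWeight i * z i) H = eval z H := by
    have := isWeightedHomogeneous_aeval_scale hH (0 : ℂ) z
    rw [pow_zero, one_mul] at this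
    exact this
  have h2 : eval (fun i => (0 : ℂ) ^ pointWeight i * z i) (rename Sum.inr F) = 0 := by
    rw [eval_rename]
    have : ((fun i => (0 : ℂ) ^ pointWeight i * z i) ∘ Sum.inr) = (0 : ℂ) • (z ∘ Sum.inr) :=
      scale_pointWeight_inr 0 z
    rw [this, isHomogeneous_eval_smul hF, zero_pow (by omega), zero_mul]
  have h3 : eval (fun i => (0 : ℂ) ^ pointWeight i * z i) (aeval (reflSubst F) H) = 0 := by
    obtain ⟨K, hK⟩ := hdvd
    rw [hK, map_mul, h2, zero_mul]
  rw [eval_aeval_poly] at h3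
  rw [← h1, map_zero]
  refine Eq.trans ?_ h3
  congr 2
  funext i
  rw [eval_reflSubst_scale hF]
  cases i with
  | inl i => simp [pointWeight, reflSubst]
  | inr i => simp [pointWeight]

theorem not_dvd_rename {G : Poly3} (h : ¬ F ∣ G) :
    ¬ (rename Sum.inr F : Poly6) ∣ rename Sum.inr G := by
  intro hc
  have := map_dvd (lightAt 0) hc
  rw [lightAt_rename, lightAt_rename] at this
  exact h this

theorem not_dvd_X (hd : 2 ≤ d) (hF : F.IsHomogeneous d) (hirr : Irreducible F) (i : Fin 3) :
    ¬ F ∣ X i :=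
  not_dvd_of_lt_degree hF hirr.ne_zero (isHomogeneous_X ℂ i) (X_ne_zero i) (by omega)

theorem tangentDerivation_self (F : Poly3) : tangentDerivation F (rename Sum.inr F) = 0 := by
  rw [tangentDerivation_apply, pderiv_rename Sum.inr_injective, pderiv_rename Sum.inr_injective]
  ring

theorem dot_X_gradPoly (hF : F.IsHomogeneous d) : (X : Fin 3 → Poly3) ⬝ᵥ gradPoly F = d • F :=
  hF.sum_X_mul_pderiv

/-- A normal vanishing on the curve would make the point parallel to `(F_x, F_y, 0)`. Pairing with
the gradient would then kill `(F_x² + F_y²) z`, a product of factors not divisible by `F`. -/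
theorem not_dvd_normal (hd : 2 ≤ d) (hF : F.IsHomogeneous d) (hirr : Irreducible F) :
    ∃ i, ¬ F ∣ ((X : Fin 3 → Poly3) ⨯₃ ![pderiv 0 F, pderiv 1 F, 0]) i := by
  by_contra! hc
  have e := dot_mul_sub_dot_mul (X : Fin 3 → Poly3) ![pderiv 0 F, pderiv 1 F, 0] (gradPoly F) 2
  have hh : F ∣ (pderiv 0 F ^ 2 + pderiv 1 F ^ 2) * X 2 := by
    have e2 : (pderiv 0 F ^ 2 + pderiv 1 F ^ 2) * X 2 =
        -(((X : Fin 3 → Poly3) ⨯₃ ![pderiv 0 F, pderiv 1 F, 0]) ⨯₃ gradPoly F) 2 := by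
      have : (![pderiv 0 F, pderiv 1 F, 0] : Fin 3 → Poly3) ⬝ᵥ gradPoly F =
          pderiv 0 F ^ 2 + pderiv 1 F ^ 2 := by
        simp [dotProduct, Fin.sum_univ_three, gradPoly, sq]
      rw [this] at e
      simp only [Matrix.cons_val, mul_zero] at e
      linear_combination -e
    rw [e2, dvd_neg, cross_apply]
    exact dvd_sub (Dvd.dvd.mul_right (hc 0) _) (Dvd.dvd.mul_right (hc 1) _)
  rcases hirr.prime.dvd_or_dvd hh with h | h
  · exact not_dvd_sq_add_sq hd hF hirr h
  · exact not_dvd_X hd hF hirr 2 h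

/-- A generic inverse of the reflected-line map, with coefficients polynomial in the light
position: `Y × ∂H/∂S`, where `H(S, Y)` is the equation of the curve of reflected lines. -/
theorem exists_family_inverse (hd : 2 ≤ d) (hF : F.IsHomogeneous d) (hirr : Irreducible F) :
    ∃ (e : ℕ) (g : Fin 3 → Poly6), (∀ i, (g i).IsWeightedHomogeneous pointWeight e) ∧
      (∀ i j, rename Sum.inr F ∣ aeval (reflSubst F) (g i) * X (Sum.inr j) -
        aeval (reflSubst F) (g j) * X (Sum.inr i)) ∧
      ∃ k, ¬ rename Sum.inr F ∣ aeval (reflSubst F) (g k) := by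
  classical
  have hP := prime_rename_inr hirr.prime
  obtain ⟨n, H, hH, -, hHF, -, k, hk, hkF⟩ := exists_minimal_relation hP
    (eval_rename_inr_scale hF) (e := 1 + ((d - 1) + (d - 1))) (by omega) (eval_reflSubst_scale hF)
    (fun H => eq_zero_of_dvd_aeval_reflSubst hd hF)
  have hPI : (Ideal.span {(rename Sum.inr F : Poly6)}).IsPrime :=
    (Ideal.span_singleton_prime hP.ne_zero).2 hP
  set q := Ideal.Quotient.mk (Ideal.span {(rename Sum.inr F : Poly6)}) with hq
  have hq0 : ∀ G, q G = 0 ↔ rename Sum.inr F ∣ G := Ideal.Quotient.eq_zero_iff_dvd _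
  set Ψ := reflSubst F with hΨ
  let xp : Fin 3 → Poly6 := fun i => X (Sum.inr i)
  let tp : Fin 3 → Poly6 := fun i => rename Sum.inr (pderiv i F)
  let sp : Fin 3 → Poly6 := fun i => X (Sum.inl i)
  let wp : Fin 3 → Poly6 := fun i => aeval Ψ (pderiv (Sum.inr i) H)
  let lp : Fin 3 → Poly6 := fun i => aeval Ψ (pderiv (Sum.inl i) H)
  let x := fun i => q (xp i)
  let t := fun i => q (tp i)
  let s := fun i => q (sp i)
  let w := fun i => q (wp i)
  let l := fun i => q (lp i)
  let r := fun i => q (tangentDerivation F (rhoFamily F i))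
  have hρ : ∀ i, q (rhoFamily F i) = (x ⨯₃ orthSymm t s) i := fun i =>
    map_cross_orthSymm_apply q xp tp sp i
  have hρ' : (fun i => q (rhoFamily F i)) = x ⨯₃ orthSymm t s := _root_.funext hρ
  have h2 : (2 : Poly6 ⧸ Ideal.span {(rename Sum.inr F : Poly6)}) ≠ 0 := by
    intro h
    have h' : q (C 2) = 0 := by
      have : q (C 2) = 2 := by
        rw [map_ofNat C 2]; exact map_ofNat q 2
      rw [this, h]
    rw [hq0] at h'
    have := hP.not_isUnit
    exact this (isUnit_of_dvd_unit h' ((isUnit_iff_ne_zero.2 two_ne_zero).map C))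
  have hxt : x ⬝ᵥ t = 0 := by
    have : xp ⬝ᵥ tp = rename Sum.inr (d • F) := by
      rw [← dot_X_gradPoly hF]
      simp [dotProduct, gradPoly, xp, tp]
    have h := map_dot q xp tp
    rw [this, (hq0 _).2 (by rw [map_nsmul]; exact dvd_smul_of_dvd d dvd_rfl)] at h
    exact h.symm
  have hN : t 0 ^ 2 + t 1 ^ 2 ≠ 0 := by
    have : t 0 ^ 2 + t 1 ^ 2 = q (rename Sum.inr (pderiv 0 F ^ 2 + pderiv 1 F ^ 2)) := by
      simp [t, tp]
    rw [this, Ne, hq0]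
    exact not_dvd_rename (not_dvd_sq_add_sq hd hF hirr)
  have hx : x 2 ≠ 0 := by
    have : x 2 = q (rename Sum.inr (X 2)) := by simp [x, xp]
    rw [this, Ne, hq0]
    exact not_dvd_rename (not_dvd_X hd hF hirr 2)
  have hts : t ⬝ᵥ s ≠ 0 := by
    rw [← map_dot q tp sp, Ne, hq0]
    intro h
    -- Non-divisibility in the family follows from one light position, here the first basis vector.
    have := map_dvd (lightAt (Pi.single 0 1)) h
    refine not_dvd_polar hd hF hirr (v := Pi.single 0 1) (by simp) ?_
    simpa [dotProduct, tp, sp, mul_comm] using this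
  have hns : (x ⨯₃ ![t 0, t 1, 0]) ⬝ᵥ s ≠ 0 := by
    obtain ⟨i, hi⟩ := not_dvd_normal hd hF hirr
    have e : (x ⨯₃ ![t 0, t 1, 0]) ⬝ᵥ s = q ((xp ⨯₃ ![tp 0, tp 1, 0]) ⬝ᵥ sp) := by
      simp [dotProduct, Fin.sum_univ_three, cross_apply, x, t, s]
      ring
    rw [e, Ne, hq0]
    intro h
    have := map_dvd (lightAt (Pi.single i 1)) h
    apply hi
    fin_cases i <;>
      simpa [dotProduct, Fin.sum_univ_three, cross_apply, tp, sp, xp] using this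
  have hw : w ≠ 0 := by
    cases k with
    | inl k => exact absurd rfl hk
    | inr k => exact fun h => hkF ((hq0 _).1 (congrFun h k))
  -- Euler's identity for `H` in the line variables.
  have hwr : w ⬝ᵥ (x ⨯₃ orthSymm t s) = 0 := by
    rw [← hρ', ← map_dot q wp (rhoFamily F), hq0]
    have he := congrArg (aeval Ψ) hH.sum_weight_X_mul_pderiv
    simp only [Fintype.sum_sum_type, map_sum, map_add, map_nsmul, map_mul, aeval_X] at he
    simp only [pointWeight, Sum.elim_inl, Sum.elim_inr, Pi.zero_apply, Pi.one_apply, zero_smul,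
      one_smul, Finset.sum_const_zero, zero_add] at he
    have : wp ⬝ᵥ rhoFamily F = n • aeval Ψ H := by
      rw [← he]
      exact Finset.sum_congr rfl fun i _ => by simp [wp, hΨ, reflSubst, mul_comm]
    rw [this]
    exact dvd_smul_of_dvd n hHF
  -- The relation `H` differentiated along the curve with the light fixed.
  have hwr' : w ⬝ᵥ r = 0 := by
    rw [← map_dot q wp (fun i => tangentDerivation F (rhoFamily F i)), hq0]
    have h := dvd_derivation_of_dvd (tangentDerivation F)
      (by rw [tangentDerivation_self]; exact dvd_zero _) hHF
    rw [derivation_aeval, Fintype.sum_sum_type, Finset.sum_eq_zero, zero_add] at h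
    · exact h
    · intro i _
      simp [hΨ, reflSubst, tangentDerivation_apply, pderiv_X]
  -- The incidence `x·ρ = 0` differentiated along the curve.
  have hr : ![-t 1, t 0, 0] ⬝ᵥ (x ⨯₃ orthSymm t s) + x ⬝ᵥ r = 0 := by
    have h0 : xp ⬝ᵥ rhoFamily F = 0 := dot_self_cross _ _
    have h1 := congrArg (fun G => q (tangentDerivation F G)) h0
    simp only [dotProduct, Fin.sum_univ_three, map_add, Derivation.leibniz, smul_eq_mul, map_mul,
      map_zero] at h1
    have e0 : q (tangentDerivation F (xp 0)) = -t 1 := by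
      simp [xp, tangentDerivation_apply, pderiv_X, t, tp]
    have e1 : q (tangentDerivation F (xp 1)) = t 0 := by
      simp [xp, tangentDerivation_apply, pderiv_X, t, tp]
    have e2 : q (tangentDerivation F (xp 2)) = 0 := by
      simp [xp, tangentDerivation_apply, pderiv_X]
    rw [e0, e1, e2] at h1
    rw [← hρ']
    simp only [dotProduct, Fin.sum_univ_three, Matrix.cons_val]
    linear_combination h1
  -- The relation `H` differentiated in the light with the point fixed, one coordinate at a time.
  have hlj : ∀ j, l j + w ⬝ᵥ (x ⨯₃ orthSymm t (Pi.single j 1)) = 0 := by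
    intro j
    have h := dvd_derivation_of_dvd (pderiv (Sum.inl j))
      (by rw [pderiv_inl_rename_inr]; exact dvd_zero _) hHF
    rw [derivation_aeval, Fintype.sum_sum_type] at h
    rw [← hq0, map_add] at h
    have e1 : ∑ i, aeval Ψ (pderiv (Sum.inl i) H) * pderiv (Sum.inl j) (Ψ (Sum.inl i)) = lp j := by
      rw [Finset.sum_eq_single j]
      · simp [hΨ, reflSubst, lp]
      · intro i _ hij
        simp [hΨ, reflSubst, pderiv_X, hij]
      · simp
    have e2 : q (∑ i, aeval Ψ (pderiv (Sum.inr i) H) * pderiv (Sum.inl j) (Ψ (Sum.inr i))) =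
        w ⬝ᵥ (x ⨯₃ orthSymm t (Pi.single j 1)) := by
      rw [map_sum]
      refine Finset.sum_congr rfl fun i _ => ?_
      rw [map_mul, hΨ]
      simp only [reflSubst, Sum.elim_inr]
      rw [pderiv_inl_rhoFamily, map_cross_orthSymm_apply]
      have : (fun k => q ((Pi.single j 1 : Fin 3 → Poly6) k)) = Pi.single j 1 := by
        funext k
        simp [Pi.single_apply, apply_ite q]
      rw [this]
      rfl
    rw [e1, e2] at h
    exact h
  have hl : ∀ v, l ⬝ᵥ v + w ⬝ᵥ (x ⨯₃ orthSymm t v) = 0 := by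
    intro v
    have e0 := hlj 0
    have e1 := hlj 1
    have e2 := hlj 2
    simp [dotProduct, Fin.sum_univ_three, cross_apply, orthSymm_apply] at e0 e1 e2 ⊢
    linear_combination v 0 * e0 + v 1 * e1 + v 2 * e2
  let g : Fin 3 → Poly6 := (fun i => X (Sum.inr i)) ⨯₃ (fun i => pderiv (Sum.inl i) H)
  have hgq : ∀ i, q (aeval Ψ (g i)) = ((x ⨯₃ orthSymm t s) ⨯₃ l) i := by
    intro i
    have h := map_cross_apply (q.comp (aeval Ψ : Poly6 →ₐ[ℂ] Poly6).toRingHom)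
      (fun i => X (Sum.inr i)) (fun i => pderiv (Sum.inl i) H) i
    rw [← hρ']
    simpa [hΨ, reflSubst, g, l, lp] using h
  refine ⟨1 + n, g, ?_, ?_, ?_⟩
  · intro i
    have hX : ∀ i : Fin 3, (X (Sum.inr i) : Poly6).IsWeightedHomogeneous pointWeight 1 :=
      fun i => isWeightedHomogeneous_X ℂ pointWeight (Sum.inr i)
    have hp : ∀ i : Fin 3, (pderiv (Sum.inl i) H).IsWeightedHomogeneous pointWeight n :=
      fun i => hH.pderiv rfl
    simp only [g, cross_apply]
    fin_cases i
    · exact ((hX 1).mul (hp 2)).sub ((hX 2).mul (hp 1))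
    · exact ((hX 2).mul (hp 0)).sub ((hX 0).mul (hp 2))
    · exact ((hX 0).mul (hp 1)).sub ((hX 1).mul (hp 0))
  · intro i j
    rw [← hq0, map_sub, map_mul, map_mul, hgq, hgq]
    have := cross_reflected_mul_comm (s := s) hxt hl i j
    linear_combination -this
  · have := cross_reflected_ne_zero h2 hxt hN hx hts hns hw hwr hwr' hr hl
    obtain ⟨i, hi⟩ := Function.ne_iff.1 this
    exact ⟨i, fun h => hi (by rw [← hgq, (hq0 _).2 h]; rfl)⟩

end Family

/-! ### Fixing the light position -/

section Specialization

variable {F : Poly3} {d : ℕ}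

theorem isHomogeneous_lightAt {G : Poly6} {e : ℕ} (hG : G.IsWeightedHomogeneous pointWeight e)
    (s : Fin 3 → ℂ) : (lightAt s G).IsHomogeneous e := by
  induction hG using IsWeightedHomogeneous.induction_on with
  | zero => simpa using isHomogeneous_zero (Fin 3) ℂ e
  | add p q hp hq h1 h2 => rw [map_add]; exact h1.add h2
  | monomial m r hr =>
    subst hr
    rw [lightAt, aeval_monomial, Finsupp.weight_apply]
    refine IsHomogeneous.C_mul ?_ r
    refine IsHomogeneous.prod _ _ (fun i => m i • pointWeight i) fun i _ => ?_
    rw [smul_eq_mul, mul_comm]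
    refine IsHomogeneous.pow ?_ _
    cases i with
    | inl i => exact isHomogeneous_C _ _
    | inr i => exact isHomogeneous_X ℂ i

theorem aeval_rhoCoord_lightAt (F : Poly3) (s : Fin 3 → ℂ) (G : Poly6) :
    aeval (rhoCoord F s) (lightAt s G) = lightAt s (aeval (reflSubst F) G) := by
  have : (aeval (rhoCoord F s)).comp (lightAt s) = (lightAt s).comp (aeval (reflSubst F)) := by
    refine MvPolynomial.algHom_ext fun i => ?_
    cases i with
    | inl i => simp [reflSubst, ← algebraMap_eq]
    | inr i => simp [reflSubst, lightAt_rhoFamily]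
  exact DFunLike.congr_fun this G

/-- The reflected-line map has a generic inverse for every light position off a hypersurface. -/
theorem exists_hasFormInverse_rhoCoord (hd : 2 ≤ d) (hF : F.IsHomogeneous d)
    (hirr : Irreducible F) : ∃ G : Poly3, G ≠ 0 ∧
      ∀ s, eval s G ≠ 0 → HasFormInverse F (rhoCoord F s) := by
  obtain ⟨e, g, hg, hgX, k, hk⟩ := exists_family_inverse hd hF hirr
  obtain ⟨z, hz, hne⟩ := exists_zero_eval_ne_zero (prime_rename_inr hirr.prime) hk
  rw [eval_rename] at hz
  rw [← Sum.elim_comp_inl_inr z] at hne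
  -- At one fixed point of the curve where `g k` is nonzero for some light, its value is a nonzero
  -- polynomial in the light; off its zeros the specialized inverse is still nontrivial.
  refine ⟨pointAt (z ∘ Sum.inr) (aeval (reflSubst F) (g k)), ?_, ?_⟩
  · intro h
    rw [← eval_pointAt, h, map_zero] at hne
    exact hne rfl
  · intro s hs
    refine ⟨e, fun i => lightAt s (g i), fun i => isHomogeneous_lightAt (hg i) s, ?_, k, ?_⟩
    · intro i j
      have := map_dvd (lightAt s) (hgX i j)
      simpa only [aeval_rhoCoord_lightAt, map_sub, map_mul, lightAt_X_inr, lightAt_rename]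
        using this
    · rintro ⟨K, hK⟩
      rw [aeval_rhoCoord_lightAt] at hK
      rw [eval_pointAt, ← eval_lightAt, hK, map_mul, hz, zero_mul] at hs
      exact hs rfl

theorem hasFormInverse_of_smul {f : Fin 3 → Poly3} {c : ℂ} (hc : c ≠ 0)
    (h : HasFormInverse F ((C c : Poly3) • f)) : HasFormInverse F f := by
  obtain ⟨e, g, hg, hgX, k, hk⟩ := h
  have hs : ∀ i, aeval ((C c : Poly3) • f) (g i) = C (c ^ e) * aeval f (g i) := by
    intro i
    rw [isHomogeneous_aeval_smul (hg i), map_pow]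
  have hu : IsUnit (C (c ^ e) : Poly3) := (isUnit_iff_ne_zero.2 (pow_ne_zero e hc)).map C
  refine ⟨e, g, hg, fun i j => ?_, k, fun h => hk ?_⟩
  · have := hgX i j
    rwa [hs, hs, mul_assoc, mul_assoc, ← mul_sub, hu.dvd_mul_left] at this
  · rw [hs]
    exact Dvd.dvd.mul_left h _

theorem rhoCoord_smul (F : Poly3) (c : ℂ) (s : Fin 3 → ℂ) :
    rhoCoord F (c • s) = (C c : Poly3) • rhoCoord F s := by
  funext i
  fin_cases i <;> simp [rhoCoord, cross_apply, orthSymm_apply] <;> ring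

end Specialization

/-! ### Reflected lines that are not concurrent -/

section NonLinearity

variable {F : Poly3} {d : ℕ}

theorem eval_rhoCoord (F : Poly3) (s m : Fin 3 → ℂ) (i : Fin 3) : eval m (rhoCoord F s i) =
    (m ⨯₃ orthSymm (fun j => eval m (pderiv j F)) s) i := by
  have := map_cross_orthSymm_apply (eval m) X (gradPoly F) (fun i => C (s i)) i
  simpa [rhoCoord, gradPoly] using this

theorem dot_eval_pderiv (hF : F.IsHomogeneous d) {m : Fin 3 → ℂ} (hm : eval m F = 0) :
    m ⬝ᵥ (fun j => eval m (pderiv j F)) = 0 := by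
  have := congrArg (eval m) hF.sum_X_mul_pderiv
  simpa [dotProduct, hm] using this

theorem cross_ne_zero_of_dot {k : Type*} [Field k] {a b v : Fin 3 → k} (hb : b ≠ 0)
    (hbv : b ⬝ᵥ v = 0) (hav : a ⬝ᵥ v ≠ 0) : b ⨯₃ a ≠ 0 := by
  intro h
  apply hb
  funext i
  have := dot_mul_sub_dot_mul a b v i
  have hab : a ⨯₃ b = 0 := by rw [← cross_anticomm, h, neg_zero]
  rw [hbv, hab] at this
  simpa [hav] using this

theorem eval_polar (F : Poly3) (v m : Fin 3 → ℂ) :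
    eval m (∑ i, C (v i) * pderiv i F) = v ⬝ᵥ fun j => eval m (pderiv j F) := by
  simp [dotProduct]

/-- Three points of the curve and a light position the reflected lines of which are not
concurrent. -/
theorem exists_reflected_lines_independent (hd : 2 ≤ d) (hF : F.IsHomogeneous d)
    (hirr : Irreducible F) : ∃ (m : Fin 3 → Fin 3 → ℂ) (s : Fin 3 → ℂ),
      (∀ a, eval (m a) F = 0) ∧
      ((fun i => eval (m 0) (rhoCoord F s i)) ⨯₃ (fun i => eval (m 1) (rhoCoord F s i))) ⬝ᵥ
        (fun i => eval (m 2) (rhoCoord F s i)) ≠ 0 := by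
  have hp := hirr.prime
  have hN := not_dvd_sq_add_sq hd hF hirr
  let τ : (Fin 3 → ℂ) → Fin 3 → ℂ := fun m j => eval m (pderiv j F)
  obtain ⟨m₃, h3, hne⟩ := exists_zero_eval_ne_zero hp
    (hp.not_dvd_mul hN (not_dvd_X hd hF hirr 2))
  simp only [map_mul, map_add, map_pow, eval_X] at hne
  have hN3 : τ m₃ 0 ^ 2 + τ m₃ 1 ^ 2 ≠ 0 := left_ne_zero_of_mul hne
  have hx3 : m₃ 2 ≠ 0 := right_ne_zero_of_mul hne
  have hE3 : m₃ ⬝ᵥ τ m₃ = 0 := dot_eval_pderiv hF h3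
  have hτ3 : τ m₃ ≠ 0 := fun h => hN3 (by simp [h])
  -- The normal at `m₃`. Below, `v` is chosen on the tangent and `u` on the normal at `m₃`; keeping
  -- both off the tangent at `m₁` makes that tangent differ from these two lines.
  let ν : Fin 3 → ℂ := m₃ ⨯₃ ![τ m₃ 0, τ m₃ 1, 0]
  have hν : ν ≠ 0 := by
    refine cross_ne_zero_of_dot (v := τ m₃) (fun h => hx3 (congrFun h 2)) hE3 ?_
    simpa [dotProduct, Fin.sum_univ_three, sq] using hN3
  obtain ⟨v, hv, hv3⟩ := exists_ne_zero_orthogonal (τ m₃)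
  obtain ⟨u, hu, huν⟩ := exists_ne_zero_orthogonal ν
  obtain ⟨m₁, h1, hne⟩ := exists_zero_eval_ne_zero hp
    (hp.not_dvd_mul (hp.not_dvd_mul hN (not_dvd_X hd hF hirr 2))
      (hp.not_dvd_mul (not_dvd_polar hd hF hirr hv) (not_dvd_polar hd hF hirr hu)))
  rw [map_mul, map_mul, map_mul, eval_polar, eval_polar] at hne
  simp only [map_add, map_pow, eval_X] at hne
  have hN1 : τ m₁ 0 ^ 2 + τ m₁ 1 ^ 2 ≠ 0 := left_ne_zero_of_mul (left_ne_zero_of_mul hne)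
  have hx1 : m₁ 2 ≠ 0 := right_ne_zero_of_mul (left_ne_zero_of_mul hne)
  have hv1 : v ⬝ᵥ τ m₁ ≠ 0 := left_ne_zero_of_mul (right_ne_zero_of_mul hne)
  have hu1 : u ⬝ᵥ τ m₁ ≠ 0 := right_ne_zero_of_mul (right_ne_zero_of_mul hne)
  have hE1 : m₁ ⬝ᵥ τ m₁ = 0 := dot_eval_pderiv hF h1
  have hτ1 : τ m₁ ≠ 0 := fun h => hN1 (by simp [h])
  have hc3 : τ m₃ ⨯₃ τ m₁ ≠ 0 := cross_ne_zero_of_dot (v := v) hτ3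
    (by rwa [dotProduct_comm]) (by rwa [dotProduct_comm])
  have hcν : ν ⨯₃ τ m₁ ≠ 0 := cross_ne_zero_of_dot (v := u) hν
    (by rwa [dotProduct_comm]) (by rwa [dotProduct_comm])
  obtain ⟨m₂, h2, hne⟩ := exists_zero_eval_ne_zero hp
    (hp.not_dvd_mul (hp.not_dvd_mul hN (not_dvd_linForm hd hF hirr.ne_zero hτ1))
      (hp.not_dvd_mul (not_dvd_polar hd hF hirr (v := m₁) (fun h => hx1 (congrFun h 2)))
        (hp.not_dvd_mul (not_dvd_polar hd hF hirr hc3) (not_dvd_polar hd hF hirr hcν))))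
  rw [map_mul, map_mul, map_mul, map_mul, eval_polar, eval_polar, eval_polar, eval_linForm] at hne
  simp only [map_add, map_pow] at hne
  have hN2 : τ m₂ 0 ^ 2 + τ m₂ 1 ^ 2 ≠ 0 := left_ne_zero_of_mul (left_ne_zero_of_mul hne)
  have h12 : τ m₁ ⬝ᵥ m₂ ≠ 0 := right_ne_zero_of_mul (left_ne_zero_of_mul hne)
  have hr := right_ne_zero_of_mul hne
  have h21 : m₁ ⬝ᵥ τ m₂ ≠ 0 := left_ne_zero_of_mul hr
  have hd3 : (τ m₃ ⨯₃ τ m₁) ⬝ᵥ τ m₂ ≠ 0 := left_ne_zero_of_mul (right_ne_zero_of_mul hr)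
  have hdν : (ν ⨯₃ τ m₁) ⬝ᵥ τ m₂ ≠ 0 := right_ne_zero_of_mul (right_ne_zero_of_mul hr)
  have hE2 : m₂ ⬝ᵥ τ m₂ = 0 := dot_eval_pderiv hF h2
  -- The light is the intersection of the tangents at `m₁` and `m₂`. It is fixed by both symmetries,
  -- so these tangents are their own reflected lines and meet at the light, while the third
  -- reflected line misses it because the light is off the tangent and the normal at `m₃`.
  refine ⟨![m₁, m₂, m₃], τ m₁ ⨯₃ τ m₂, ?_, ?_⟩
  · intro a
    fin_cases a
    · exact h1
    · exact h2
    · exact h3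
  · simp only [eval_rhoCoord, Matrix.cons_val]
    change ((m₁ ⨯₃ orthSymm (τ m₁) (τ m₁ ⨯₃ τ m₂)) ⨯₃ (m₂ ⨯₃ orthSymm (τ m₂) (τ m₁ ⨯₃ τ m₂))) ⬝ᵥ
      (m₃ ⨯₃ orthSymm (τ m₃) (τ m₁ ⨯₃ τ m₂)) ≠ 0
    set s := τ m₁ ⨯₃ τ m₂ with hs
    have e1 : m₁ ⨯₃ orthSymm (τ m₁) s =
        ((τ m₁ 0 ^ 2 + τ m₁ 1 ^ 2) * (m₁ ⬝ᵥ τ m₂)) • τ m₁ := by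
      rw [orthSymm_of_orthogonal (dot_self_cross _ _), map_smul,
        cross_cross_eq_smul_sub_smul', dotProduct_comm _ m₁, hE1, zero_smul, sub_zero, smul_smul]
    have e2 : m₂ ⨯₃ orthSymm (τ m₂) s =
        (-(τ m₂ 0 ^ 2 + τ m₂ 1 ^ 2) * (τ m₁ ⬝ᵥ m₂)) • τ m₂ := by
      rw [orthSymm_of_orthogonal (dot_cross_self _ _), map_smul,
        cross_cross_eq_smul_sub_smul', hE2, zero_smul, zero_sub, smul_neg, smul_smul,
        neg_mul, neg_smul]
    have e3 : s ⬝ᵥ (m₃ ⨯₃ orthSymm (τ m₃) s) = -2 * (τ m₃ ⬝ᵥ s) * (ν ⬝ᵥ s) := by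
      rw [dotProduct_comm, cross_orthSymm_dot]
    have e4 : τ m₃ ⬝ᵥ s = (τ m₃ ⨯₃ τ m₁) ⬝ᵥ τ m₂ := by
      rw [hs, triple_product_permutation, triple_product_permutation, dotProduct_comm]
    have e5 : ν ⬝ᵥ s = (ν ⨯₃ τ m₁) ⬝ᵥ τ m₂ := by
      rw [hs, triple_product_permutation, triple_product_permutation, dotProduct_comm]
    rw [e1, e2, LinearMap.map_smul₂, map_smul, smul_dotProduct, smul_dotProduct, e3, e4, e5]
    simp only [smul_eq_mul]
    exact mul_ne_zero (mul_ne_zero hN1 h21) (mul_ne_zero (mul_ne_zero (neg_ne_zero.2 hN2) h12)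
      (mul_ne_zero (mul_ne_zero (by norm_num) hd3) hdν))

/-- Off a hypersurface of light positions, the reflected lines do not all pass through one point. -/
theorem exists_rhoCoord_nonlinear (hd : 2 ≤ d) (hF : F.IsHomogeneous d)
    (hirr : Irreducible F) : ∃ G : Poly3, G ≠ 0 ∧
      ∀ s, eval s G ≠ 0 → ∀ c : Fin 3 → ℂ, F ∣ ∑ i, C (c i) * rhoCoord F s i → c = 0 := by
  obtain ⟨m, s₀, hm, hne⟩ := exists_reflected_lines_independent hd hF hirr
  let P : Fin 3 → Fin 3 → Poly3 := fun a i => pointAt (m a) (rhoFamily F i)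
  have hP : ∀ s a i, eval s (P a i) = eval (m a) (rhoCoord F s i) := by
    intro s a i
    rw [eval_pointAt, ← eval_lightAt, lightAt_rhoFamily]
  have hG : ∀ s, eval s ((P 0 ⨯₃ P 1) ⬝ᵥ P 2) =
      ((fun i => eval (m 0) (rhoCoord F s i)) ⨯₃ (fun i => eval (m 1) (rhoCoord F s i))) ⬝ᵥ
        (fun i => eval (m 2) (rhoCoord F s i)) := by
    intro s
    rw [map_dot]
    simp only [map_cross_apply, hP]
  refine ⟨(P 0 ⨯₃ P 1) ⬝ᵥ P 2, fun h => hne (by rw [← hG, h, map_zero]), ?_⟩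
  intro s hs c hc
  rw [hG] at hs
  have hv : ∀ a, c ⬝ᵥ (fun i => eval (m a) (rhoCoord F s i)) = 0 := by
    intro a
    obtain ⟨K, hK⟩ := hc
    have := congrArg (eval (m a)) hK
    simpa [dotProduct, hm a] using this
  funext i
  set p := (fun i => eval (m 0) (rhoCoord F s i)) ⨯₃ (fun i => eval (m 1) (rhoCoord F s i))
  have h1 := mul_cross_comm (hv 0) (hv 1) i
  have h2 := hv 2
  -- The vector `c` is parallel to `p` and orthogonal to the third line, but `p` is not orthogonal
  -- to that line.
  refine (mul_eq_zero.1
    (?_ : c i * (p ⬝ᵥ fun i => eval (m 2) (rhoCoord F s i)) = 0)).resolve_right hs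
  simp only [dotProduct, Fin.sum_univ_three] at h2 ⊢
  linear_combination (eval (m 2) (rhoCoord F s 0)) * h1 0 + (eval (m 2) (rhoCoord F s 1)) * h1 1 +
    (eval (m 2) (rhoCoord F s 2)) * h1 2 + p i * h2

end NonLinearity

/-! ### Envelopes and biduality -/

section Caustic

variable {F : Poly3} {d : ℕ}

/-- `tangentDeriv F` as a derivation. -/
noncomputable def planeTangentDerivation (F : Poly3) : Derivation ℂ Poly3 Poly3 :=
  pderiv 0 F • pderiv 1 - pderiv 1 F • pderiv 0

theorem planeTangentDerivation_apply (F G : Poly3) :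
    planeTangentDerivation F G = tangentDeriv F G := rfl

theorem dvd_tangentDeriv {G : Poly3} (h : F ∣ G) : F ∣ tangentDeriv F G := by
  rw [← planeTangentDerivation_apply]
  refine dvd_derivation_of_dvd _ ?_ h
  rw [planeTangentDerivation_apply, tangentDeriv, mul_comm, sub_self]
  exact dvd_zero _

/-- `exists_minimal_relation` for three forms of the same degree on a plane curve, together with the
equations satisfied by the gradient of the relation. -/
theorem exists_minimal_form_relation (hF : F.IsHomogeneous d) (hirr : Irreducible F) {e : ℕ}
    (he : 0 < e) {b : Fin 3 → Poly3} (hb : ∀ i, (b i).IsHomogeneous e) :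
    ∃ (n : ℕ) (H : Poly3), H.IsHomogeneous n ∧ H ≠ 0 ∧ F ∣ aeval b H ∧
      (∀ i, F ∣ aeval b (pderiv i H) → pderiv i H = 0) ∧
      (∃ i, ¬ F ∣ aeval b (pderiv i H)) ∧
      F ∣ ∑ i, aeval b (pderiv i H) * b i ∧
      F ∣ ∑ i, aeval b (pderiv i H) * tangentDeriv F (b i) := by
  have hsc : ∀ (c : ℂ) (z : Fin 3 → ℂ),
      (fun i => c ^ (1 : Fin 3 → ℕ) i * z i) = c • z := by
    intro c z; ext i; simp
  obtain ⟨n, H, hH, hH0, hHF, hmin, i, hi, hiF⟩ := exists_minimal_relation hirr.prime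
    (w := 1) (b := b) (e := e)
    (fun c z hz => by rw [hsc, isHomogeneous_eval_smul hF, hz, mul_zero]) he
    (fun c z j => by rw [hsc, isHomogeneous_eval_smul (hb j)]; simp) (fun H hH hdvd => by
      have h0 : H.IsHomogeneous 0 := hH
      rw [← totalDegree_zero_iff_isHomogeneous, totalDegree_eq_zero_iff_eq_C] at h0
      rw [h0] at hdvd ⊢
      by_contra hne
      have hc : coeff 0 H ≠ 0 := fun h => hne (by rw [h, map_zero])
      rw [aeval_C] at hdvd
      exact hirr.not_isUnit (isUnit_of_dvd_unit hdvd ((isUnit_iff_ne_zero.2 hc).map C)))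
  refine ⟨n, H, hH, hH0, hHF, fun i => hmin i one_ne_zero, ⟨i, hiF⟩, ?_, ?_⟩
  · have h := congrArg (aeval b) (IsHomogeneous.sum_X_mul_pderiv (show H.IsHomogeneous n from hH))
    simp only [map_sum, map_mul, aeval_X, map_nsmul] at h
    have : ∑ i, aeval b (pderiv i H) * b i = n • aeval b H := by
      rw [← h]
      exact Finset.sum_congr rfl fun i _ => mul_comm _ _
    rw [this]
    exact dvd_smul_of_dvd n hHF
  · have h := dvd_tangentDeriv hHF
    rwa [← planeTangentDerivation_apply, derivation_aeval] at h

theorem exists_algebraMap_eq_of_aeval_eq_zero {K : Type*} [Field K] [Algebra ℂ K] {u : K}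
    {h : Polynomial ℂ} (h0 : h ≠ 0) (hu : Polynomial.aeval u h = 0) :
    ∃ c : ℂ, algebraMap ℂ K c = u := by
  have halg : IsAlgebraic ℂ u := ⟨h, h0, hu⟩
  have hint : IsIntegral ℂ u := halg.isIntegral
  have hdeg := IsAlgClosed.degree_eq_one_of_irreducible ℂ (minpoly.irreducible hint)
  exact minpoly.mem_range_of_degree_eq_one ℂ u hdeg

/-- A form in which the last variable does not occur, at two elements of a field. -/
theorem exists_algebraMap_eq_of_binary_form {K : Type*} [Field K] [Algebra ℂ K] {H : Poly3} {n : ℕ}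
    (hH : H.IsHomogeneous n) (hH0 : H ≠ 0) (h2 : pderiv 2 H = 0) {u v y : K} (hv : v ≠ 0)
    (h : aeval ![u, v, y] H = 0) : ∃ c : ℂ, algebraMap ℂ K c = u / v := by
  have hz : ∀ z : Fin 3 → ℂ, eval z H = eval ![z 0, z 1, 0] H := by
    intro z
    have hp : ∑ i, C ((![0, 0, 1] : Fin 3 → ℂ) i) * pderiv i H = 0 := by
      simp [Fin.sum_univ_three, h2]
    have := eval_add_smul_of_polar_eq_zero hp ![z 0, z 1, 0] (z 2)
    rw [← this]
    congr 2
    ext i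
    fin_cases i <;> simp
  have hH' : aeval (![X 0, X 1, 0] : Fin 3 → Poly3) H = H := by
    refine MvPolynomial.funext fun z => ?_
    rw [eval_aeval_poly, hz z]
    congr 2
    ext i
    fin_cases i <;> simp
  let p : Polynomial ℂ := aeval (![Polynomial.X, 1, 0] : Fin 3 → Polynomial ℂ) H
  have hpe : ∀ c, Polynomial.eval c p = eval ![c, 1, 0] H := by
    intro c
    have := (comp_aeval_apply (f := (![Polynomial.X, 1, 0] : Fin 3 → Polynomial ℂ))
      (Polynomial.aeval c : Polynomial ℂ →ₐ[ℂ] ℂ) H)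
    rw [Polynomial.coe_aeval_eq_eval] at this
    rw [this]
    have h3 : (fun i => Polynomial.eval c ((![Polynomial.X, 1, 0] : Fin 3 → Polynomial ℂ) i)) =
        ![c, 1, 0] := by
      ext i; fin_cases i <;> simp
    rw [h3]
    rfl
  have hp0 : p ≠ 0 := by
    intro hp0
    -- Dehomogenizing recovers `H` only where `z 1 ≠ 0`, whence the factor `X 1`.
    have : X 1 * H = 0 := by
      refine MvPolynomial.funext fun z => ?_
      rw [map_mul, eval_X, map_zero]
      by_cases h1 : z 1 = 0
      · rw [h1, zero_mul]
      · have e : (![z 0, z 1, 0] : Fin 3 → ℂ) = z 1 • ![z 0 / z 1, 1, 0] := by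
          ext i; fin_cases i <;> simp <;> field_simp
        rw [hz, e, isHomogeneous_eval_smul hH, ← hpe, hp0]
        simp
    rcases mul_eq_zero.1 this with h | h
    · exact X_ne_zero 1 h
    · exact hH0 h
  refine exists_algebraMap_eq_of_aeval_eq_zero hp0 ?_
  have e1 : Polynomial.aeval (u / v) p = aeval ![u / v, 1, 0] H := by
    rw [comp_aeval_apply]
    congr 2
    ext i; fin_cases i <;> simp
  have e2 : aeval ![u, v, y] H = aeval ![u, v, 0] H := by
    conv_lhs => rw [← hH']
    rw [comp_aeval_apply]
    congr 2
    ext i; fin_cases i <;> simp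
  have e3 : (![u, v, 0] : Fin 3 → K) = v • ![u / v, 1, 0] := by
    ext i; fin_cases i <;> simp <;> field_simp
  rw [e1]
  rw [e2, e3, isHomogeneous_aeval_smul hH] at h
  exact (mul_eq_zero.1 h).resolve_left (pow_ne_zero n hv)

/-- A quotient of forms of the same degree killed by the derivation along the curve is constant. -/
theorem exists_dvd_sub_of_dvd_wronskian (hd : 2 ≤ d) (hF : F.IsHomogeneous d)
    (hirr : Irreducible F) {e : ℕ} {P Q : Poly3} (hP : P.IsHomogeneous e) (hQ : Q.IsHomogeneous e)
    (hFQ : ¬ F ∣ Q) (h : F ∣ Q * tangentDeriv F P - P * tangentDeriv F Q) :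
    ∃ c : ℂ, F ∣ P - C c * Q := by
  -- Homogeneous coordinates of the pair `(P/Q, x/z)`. Since `P/Q` has zero derivative and `x/z`
  -- does not, the minimal relation does not involve the third coordinate; thus `P/Q` is algebraic
  -- over `ℂ`, hence constant.
  let b : Fin 3 → Poly3 := ![P * X 2, Q * X 2, Q * X 0]
  have hb : ∀ i, (b i).IsHomogeneous (e + 1) := by
    intro i
    fin_cases i
    · exact hP.mul (isHomogeneous_X ℂ 2)
    · exact hQ.mul (isHomogeneous_X ℂ 2)
    · exact hQ.mul (isHomogeneous_X ℂ 0)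
  obtain ⟨n, H, hH, hH0, hHF, hmin, -, hE, hD⟩ :=
    exists_minimal_form_relation hF hirr (Nat.succ_pos e) hb
  have hprod : ∀ G K : Poly3, tangentDeriv F (G * K) =
      G * tangentDeriv F K + K * tangentDeriv F G :=
    fun G K => (planeTangentDerivation F).leibniz G K
  have hX2 : tangentDeriv F (X 2) = 0 := by simp [tangentDeriv, pderiv_X]
  have hX0 : tangentDeriv F (X 0) = -pderiv 1 F := by simp [tangentDeriv, pderiv_X]
  simp only [b, Fin.sum_univ_three, Matrix.cons_val, hprod, hX2, hX0, mul_zero, zero_add] at hE hD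
  change F ∣ aeval b (pderiv 0 H) * _ + aeval b (pderiv 1 H) * _ + aeval b (pderiv 2 H) * _ at hE hD
  have h2 : F ∣ aeval b (pderiv 2 H) * (Q * (Q * pderiv 1 F)) := by
    have := dvd_sub (dvd_sub (Dvd.dvd.mul_left hE (tangentDeriv F Q)) (Dvd.dvd.mul_left hD Q))
      (Dvd.dvd.mul_left h (-(aeval b (pderiv 0 H) * X 2)))
    convert this using 1
    ring
  have hp := hirr.prime
  have h2' : F ∣ aeval b (pderiv 2 H) := by
    by_contra hc
    exact hp.not_dvd_mul hc (hp.not_dvd_mul hFQ (hp.not_dvd_mul hFQ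
      (not_dvd_pderiv hd hF hirr 1))) h2
  have hPI : (Ideal.span {F}).IsPrime := (Ideal.span_singleton_prime hp.ne_zero).2 hp
  let A := Poly3 ⧸ Ideal.span {F}
  let K := FractionRing A
  let q : Poly3 →ₐ[ℂ] K := (IsScalarTower.toAlgHom ℂ A K).comp (Ideal.Quotient.mkₐ ℂ _)
  have hq : ∀ G, q G = 0 ↔ F ∣ G := by
    intro G
    rw [← Ideal.Quotient.eq_zero_iff_dvd F G]
    exact map_eq_zero_iff (algebraMap A K) (IsFractionRing.injective A K)
  have hz : aeval ![q (P * X 2), q (Q * X 2), q (Q * X 0)] H = 0 := by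
    rw [← (hq _).2 hHF, comp_aeval_apply]
    congr 2
    ext i; fin_cases i <;> rfl
  have hQ0 : q Q ≠ 0 := fun h => hFQ ((hq _).1 h)
  have hx0 : q (X 2) ≠ 0 := fun h => not_dvd_X hd hF hirr 2 ((hq _).1 h)
  obtain ⟨c, hc⟩ := exists_algebraMap_eq_of_binary_form hH hH0 (hmin 2 h2')
    (by rw [map_mul]; exact mul_ne_zero hQ0 hx0) hz
  refine ⟨c, (hq _).1 ?_⟩
  rw [map_mul, map_mul, mul_div_mul_right _ _ hx0, eq_div_iff hQ0] at hc
  rw [map_sub, map_mul, ← hc, ← algebraMap_eq, AlgHom.commutes, sub_self]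

theorem dvd_mul_sub_mul_of_dvd_cross {A : Type*} [CommRing A] {p : A} {u w : Fin 3 → A}
    (h : ∀ i, p ∣ (u ⨯₃ w) i) (k i : Fin 3) : p ∣ u k * w i - u i * w k := by
  have h0 : p ∣ u 1 * w 2 - u 2 * w 1 := h 0
  have h1 : p ∣ u 2 * w 0 - u 0 * w 2 := h 1
  have h2 : p ∣ u 0 * w 1 - u 1 * w 0 := h 2
  fin_cases k <;> fin_cases i <;> first
    | exact h0
    | exact h1
    | exact h2
    | exact (dvd_sub_comm).1 h0
    | exact (dvd_sub_comm).1 h1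
    | exact (dvd_sub_comm).1 h2
    | simp

theorem exists_proportional_of_dvd_cross (hd : 2 ≤ d) (hF : F.IsHomogeneous d)
    (hirr : Irreducible F) {e : ℕ} {u : Fin 3 → Poly3} (hu : ∀ i, (u i).IsHomogeneous e)
    {k : Fin 3} (hk : ¬ F ∣ u k)
    (h : ∀ i, F ∣ (u ⨯₃ fun j => tangentDeriv F (u j)) i) :
    ∃ c : Fin 3 → ℂ, c k = 1 ∧ ∀ i, F ∣ u i - C (c i) * u k := by
  have hij := fun i => dvd_mul_sub_mul_of_dvd_cross h k i
  choose c hc using fun i => exists_dvd_sub_of_dvd_wronskian hd hF hirr (hu i) (hu k) hk (hij i)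
  -- The constant chosen at `k` is replaced by `1`, which makes `c` visibly nonzero.
  refine ⟨Function.update c k 1, by simp, fun i => ?_⟩
  by_cases hi : i = k
  · subst hi; simp
  · simpa [hi] using hc i

/-- The point of contact with the envelope determines the line: if the moving line `u` has a
generic inverse and the lines `u` are not concurrent, then `u × u'` has a generic inverse. -/
theorem hasFormInverse_envelope (hd : 2 ≤ d) (hF : F.IsHomogeneous d) (hirr : Irreducible F)
    {e e' : ℕ} (he' : 0 < e') {u : Fin 3 → Poly3} (hu : ∀ i, (u i).IsHomogeneous e)
    (huv : ∀ i, ((u ⨯₃ fun j => tangentDeriv F (u j)) i).IsHomogeneous e')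
    (hlin : ∀ c : Fin 3 → ℂ, F ∣ ∑ i, C (c i) * u i → c = 0) (hinv : HasFormInverse F u) :
    (∃ l, ¬ F ∣ (u ⨯₃ fun j => tangentDeriv F (u j)) l) ∧
      HasFormInverse F (u ⨯₃ fun j => tangentDeriv F (u j)) := by
  classical
  have hp := hirr.prime
  have huk : ∀ k, ¬ F ∣ u k := by
    intro k hk
    have := hlin (Pi.single k 1) (by simpa [Pi.single_apply, apply_ite, ite_mul] using hk)
    simpa using congrFun this k
  set φ : Fin 3 → Poly3 := u ⨯₃ fun j => tangentDeriv F (u j) with hφ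
  have hφ0 : ∃ l, ¬ F ∣ φ l := by
    by_contra! hc
    obtain ⟨c, -, hc⟩ := exists_proportional_of_dvd_cross hd hF hirr hu (huk 0) hc
    have := hlin ![-c 1, 1, 0] (by
      simpa [Fin.sum_univ_three, neg_add_eq_sub] using hc 1)
    simpa using congrFun this 1
  refine ⟨hφ0, ?_⟩
  obtain ⟨l, hl⟩ := hφ0
  have huφ : u ⬝ᵥ φ = 0 := dot_self_cross _ _
  have hDuφ : (fun j => tangentDeriv F (u j)) ⬝ᵥ φ = 0 := dot_cross_self _ _
  have huDφ : u ⬝ᵥ (fun j => tangentDeriv F (φ j)) = 0 := by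
    have h := congrArg (planeTangentDerivation F) huφ
    simp only [dotProduct, Fin.sum_univ_three, map_add, Derivation.leibniz, smul_eq_mul,
      map_zero, planeTangentDerivation_apply] at h hDuφ ⊢
    linear_combination h - hDuφ
  -- Otherwise the contact point is a constant `c`, and every line `u` passes through it.
  have hW : ∃ i, ¬ F ∣ (φ ⨯₃ fun j => tangentDeriv F (φ j)) i := by
    by_contra! hc
    obtain ⟨c, hcl, hc⟩ := exists_proportional_of_dvd_cross hd hF hirr huv hl hc
    have hz : c = 0 := by
      refine hlin c ?_
      have h1 : F ∣ φ l * ∑ i, C (c i) * u i := by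
        have h2 : F ∣ ∑ i, (u i * φ i - u i * (φ i - C (c i) * φ l)) := by
          simp only [Finset.sum_sub_distrib]
          refine dvd_sub ?_ (Finset.dvd_sum fun i _ => Dvd.dvd.mul_left (hc i) _)
          have : ∑ i, u i * φ i = 0 := huφ
          rw [this]
          exact dvd_zero _
        convert h2 using 1
        rw [Finset.mul_sum]
        exact Finset.sum_congr rfl fun i _ => by ring
      exact (hp.dvd_or_dvd h1).resolve_left hl
    rw [hz] at hcl
    exact zero_ne_one hcl
  obtain ⟨n, H, hH, -, -, -, ⟨k, hk⟩, hE, hD⟩ := exists_minimal_form_relation hF hirr he' huv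
  obtain ⟨ε, g, hg, hgX, m, hm⟩ := hinv
  have hPI : (Ideal.span {F}).IsPrime := (Ideal.span_singleton_prime hp.ne_zero).2 hp
  let q : Poly3 →ₐ[ℂ] Poly3 ⧸ Ideal.span {F} := Ideal.Quotient.mkₐ ℂ _
  have hq : ∀ G, q G = 0 ↔ F ∣ G := fun G => Ideal.Quotient.eq_zero_iff_dvd F G
  -- The tangent line to the envelope at the contact point: like `u`, it is orthogonal to `φ` and
  -- `φ'`, so the two are proportional.
  let v : Fin 3 → Poly3 := fun i => aeval φ (pderiv i H)
  have hvu : ∀ i j, q (v i) * q (u j) = q (v j) * q (u i) := by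
    have hmd := fun a b : Fin 3 → Poly3 => map_dot (q : Poly3 →+* Poly3 ⧸ Ideal.span {F}) a b
    refine mul_comm_of_orthogonal (a := fun i => q (φ i))
      (b := fun i => q (tangentDeriv F (φ i))) (u := fun i => q (v i)) (v := fun i => q (u i))
      ?_ ?_ ?_ ?_ ?_
    · obtain ⟨i, hi⟩ := hW
      intro h
      apply hi
      rw [← hq]
      have := map_cross_apply (q : Poly3 →+* Poly3 ⧸ Ideal.span {F}) φ
        (fun j => tangentDeriv F (φ j)) i
      exact this.trans (congrFun h i)
    · exact (hmd v φ).symm.trans ((hq _).2 hE)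
    · exact (hmd v _).symm.trans ((hq _).2 hD)
    · exact (hmd u φ).symm.trans (by rw [huφ]; exact map_zero q)
    · exact (hmd u _).symm.trans (by rw [huDφ]; exact map_zero q)
  have hvk : q (v k) ≠ 0 := fun h => hk ((hq _).1 h)
  have huk0 : q (u k) ≠ 0 := fun h => huk k ((hq _).1 h)
  have hgv : ∀ i, q (u k) ^ ε * q (aeval v (g i)) = q (v k) ^ ε * q (aeval u (g i)) := by
    intro i
    rw [comp_aeval_apply v q, comp_aeval_apply u q, ← isHomogeneous_aeval_smul (hg i),
      ← isHomogeneous_aeval_smul (hg i)]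
    congr 2
    ext j
    simp only [Pi.smul_apply, smul_eq_mul]
    linear_combination hvu j k
  have hcomp : ∀ i, aeval φ (aeval (fun j => pderiv j H) (g i)) = aeval v (g i) := by
    intro i
    rw [comp_aeval_apply]
  refine ⟨(n - 1) * ε, fun i => aeval (fun j => pderiv j H) (g i),
    fun i => (hg i).aeval _ fun j => hH.pderiv, fun i j => ?_, m, fun h => ?_⟩
  · rw [hcomp, hcomp, ← hq, map_sub, map_mul, map_mul]
    have h1 := (hq _).2 (hgX i j)
    rw [map_sub, map_mul, map_mul] at h1
    refine (mul_eq_zero.1 (?_ : q (u k) ^ ε * _ = 0)).resolve_left (pow_ne_zero ε huk0)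
    linear_combination q (X j) * hgv i - q (X i) * hgv j + q (v k) ^ ε * h1
  · rw [hcomp, ← hq] at h
    have h1 := hgv m
    rw [h, mul_zero, eq_comm] at h1
    exact hm ((hq _).1 ((mul_eq_zero.1 h1).resolve_left (pow_ne_zero ε hvk)))

end Caustic

/-! ### The generic light position -/

theorem theorem1 (F : Poly3) (d : ℕ) (hd : 2 ≤ d) (hF : F.IsHomogeneous d)
    (hirr : Irreducible F) :
    ∃ (n : ℕ) (G : Poly3), 0 < n ∧ G.IsHomogeneous n ∧ G ≠ 0 ∧
      ∀ (s : Fin 3 → ℂ) (hs : s ≠ 0), Projectivization.mk ℂ s hs ∉ projZeroLocus G →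
        (rhoMap F hF s).IsBirationalOn (projZeroLocus F) ∧
        (phiMap F hF s).IsBirationalOn (projZeroLocus F) := by
  obtain ⟨G₁, hG₁, h₁⟩ := exists_hasFormInverse_rhoCoord hd hF hirr
  obtain ⟨G₂, hG₂, h₂⟩ := exists_rhoCoord_nonlinear hd hF hirr
  obtain ⟨n, G, hGn, hG0, hG⟩ := exists_homogeneous_of_scaling (mul_ne_zero hG₁ hG₂)
  -- The extra factor makes the degree positive even when `n = 0`.
  have hGX : (G * X 0).IsHomogeneous (n + 1) := hGn.mul (isHomogeneous_X ℂ 0)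
  refine ⟨n + 1, G * X 0, Nat.succ_pos n, hGX, mul_ne_zero hG0 (X_ne_zero 0), ?_⟩
  intro s hs hmem
  rw [mk_mem_projZeroLocus hs hGX, map_mul] at hmem
  -- The conditions `G₁` and `G₂` need not be homogeneous, so they are met at a multiple `c • s`;
  -- rescaling the light only multiplies `rhoCoord` by `c`.
  obtain ⟨c, hc, hcs⟩ := hG s (left_ne_zero_of_mul hmem)
  rw [map_mul] at hcs
  have hinv : HasFormInverse F (rhoCoord F s) := by
    refine hasFormInverse_of_smul hc ?_
    rw [← rhoCoord_smul]
    exact h₁ _ (left_ne_zero_of_mul hcs)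
  have hlin : ∀ a : Fin 3 → ℂ, F ∣ ∑ i, C (a i) * rhoCoord F s i → a = 0 := by
    intro a ha
    refine h₂ _ (right_ne_zero_of_mul hcs) a ?_
    rw [rhoCoord_smul]
    have : ∑ i, C (a i) * ((C c : Poly3) • rhoCoord F s) i =
        C c * ∑ i, C (a i) * rhoCoord F s i := by
      rw [Finset.mul_sum]
      exact Finset.sum_congr rfl fun i _ => by
        simp only [Pi.smul_apply, smul_eq_mul]; ring
    rw [this]
    exact Dvd.dvd.mul_left ha _
  have hX := not_dvd_X hd hF hirr 0
  have hφ := hasFormInverse_envelope hd hF hirr (e' := (phiMap F hF s).deg)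
    (by change 0 < (1 + _) + _; omega) (isHomogeneous_rhoCoord hF s)
    (phiMap F hF s).homogeneous hlin hinv
  refine ⟨isBirationalOn_of_hasFormInverse hF hirr.prime hX _ ⟨0, fun h => ?_⟩ hinv,
    isBirationalOn_of_hasFormInverse hF hirr.prime hX _ hφ.1 hφ.2⟩
  have h' : F ∣ rhoCoord F s 0 := h
  have := hlin ![1, 0, 0] (by simpa [Fin.sum_univ_three] using h')
  simpa using congrFun this 0
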